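/- Let $n\ge 3$, $\beta\in(0,1)$, $p\in[0,1]$. All graphs are directed graphs without loops on the node set $V=\{1,\dots,n\}$, identified with their arc sets. For a graph $G$ let $\mathcal H_\beta(G)\subseteq\mathbb R^{G}$ be the polytope of all $x\ge 0$ with $$\sum_{j:(1,j)\in G}x_{1j}-\beta\sum_{j:(j,1)\in G}x_{j1}=1-\beta^n,\qquad \sum_{j:(i,j)\in G}x_{ij}-\beta\sum_{j:(j,i)\in G}x_{ji}=0\ \ (i\ne 1),\qquad \sum_{j:(1,j)\in G}x_{1j}=1,$$ written $Ax=b$, $x\ge 0$. A feasible basis of $\mathcal H_\beta(G)$ is a set $B\subseteq G$ of $n+1$ arcs such that the columns of $A$ indexed by $B$ form an invertible matrix $A_B$ and $A_B^{-1}b\ge 0$; the extreme point of $B$ is the vector $x$ with components $A_B^{-1}b$ on $B$ and $0$ outside $B$, and its support is the graph $S=\{(i,j): x_{ij}>0\}$ on $V$. A short cycle is a cycle $1\to v_1\to\dots\to v_k\to 1$ with distinct nodes $1,v_1,\dots,v_k$ and $1\le k<n-1$. A noose path is a path $1\to v_1\to\dots\to v_k\to v_j$ with distinct nodes $1,v_1,\dots,v_k$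 and $1\le j<k$; its noose cycle is $v_j\to\dots\to v_k\to v_j$. A splitting node of $S$ is a node of out-degree two. A feasible basis is called Hamiltonian if the support $S$ of its extreme point is a Hamiltonian cycle. Otherwise it is non-Hamiltonian, and it is * of Type 1 if $S$ is the union of a short cycle and a noose path, every node has in-degree at least one in $S$, the short cycle and the noose cycle are node-disjoint, and one arc connects the splitting node, which lies on the short cycle, to a node of the noose cycle; * of Type 2 if the same holds, except that the splitting node is linked to a node of the noose cycle by a path of length at least two, whose inner nodes lie on neither cycle; * of Type 3 if $S$ is the union of a short cycle and a noose path, every node has in-degree at least one in $S$, and the short cycle and the noose cycle have at least one node in common; * of Type 4 if at least one node has degree zero in $S$. Let $G_{n,p}$ be the directed binomial random graph: each ordered pair of distinct nodes of $V$ is, independently, an arc with probability $p$. **Theorem.** For the polytope $\mathcal H_\beta(G_{n,p})$, the expected number of 1. Hamiltonian bases is $(n-2)\,n!\,p^{n+1}$; 2. non-Hamiltonian bases of Type 1 is $\frac12(n-3)\,n!\,p^{n+1}$; 3. non-Hamiltonian bases of Type 2 is $\frac16(n-4)(n-3)(n+1)\,(n-1)!\,p^{n+1}$; 4. non-Hamiltonian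 bases of Type 3 is $\frac16(n-2)(n-1)\,n!\,p^{n+1}$; 5. non-Hamiltonian bases of Type 4 is, if $n\ge 4$, at least $(n-1)(n-2)(n-3)^{n-5}2^{n-4}p^{n+1}$. -/

import Mathlib

open MeasureTheory ProbabilityTheory
open scoped Nat Matrix

/-- The arcs of the complete directed graph (without loops) on the node set `V`. A directed graph on
`V` is given by its set of arcs, a term of `Set (Arc V)`. -/
abbrev Arc (V : Type*) : Type _ := {e : V × V // e.1 ≠ e.2}

namespace Arc

/-- The node at which the arc starts. -/
def tail {V : Type*} (e : Arc V) : V := e.1.1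

/-- The node at which the arc ends. -/
def head {V : Type*} (e : Arc V) : V := e.1.2

end Arc

section Paths

variable {V : Type*}

/-- The arcs `(a, b)` traversed by a walk, where `a`, `b` are consecutive entries of the list of
nodes of the walk. -/
def walkArcs (l : List V) : Set (Arc V) := {e | [e.tail, e.head] <:+: l}

/-- In the graph `S`, every node has in-degree at least one. -/
def EveryInDegreePos (S : Set (Arc V)) : Prop := ∀ v, ∃ e ∈ S, e.head = v

/-- In the graph `S`, at least one node has degree zero. -/
def HasIsolatedNode (S : Set (Arc V)) : Prop := ∃ v, ∀ e ∈ S, e.tail ≠ v ∧ e.head ≠ v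

/-- `S` is the arc set of a Hamiltonian cycle `r → v₁ → ⋯ → vₖ → r` through all nodes. -/
def IsHamiltonianCycle (r : V) (S : Set (Arc V)) : Prop :=
  ∃ vs : List V, vs ≠ [] ∧ (r :: vs).Nodup ∧ (∀ v, v ∈ r :: vs) ∧ S = walkArcs (r :: vs ++ [r])

/-- `r → v₁ → ⋯ → vₖ → r`, with `vs = [v₁, …, vₖ]`, is a short cycle: its nodes are distinct, and
`1 ≤ k < n - 1`, where `n` is the number of nodes. -/
def IsShortCycle [Fintype V] (r : V) (vs : List V) : Prop :=
  vs ≠ [] ∧ (r :: vs).Nodup ∧ vs.length + 1 < Fintype.card V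

/-- `r → us → w → ws → w` is a noose path: it consists of distinct nodes
`r, v₁, …, vₖ`, with `[v₁, …, vₖ] = us ++ w :: ws`, and finally returns to `w = vⱼ`,
where `1 ≤ j < k`. The associated noose cycle is `w → ws → w`; its nodes are the entries
of `w :: ws`. -/
def IsNoosePath (r : V) (us : List V) (w : V) (ws : List V) : Prop :=
  ws ≠ [] ∧ (r :: us ++ w :: ws).Nodup

/-- `S` is the union of the short cycle `r → vs → r` and of the noose path `r → us → w → ws → w`. -/
def IsShortCycleUnionNoose [Fintype V] (r : V) (S : Set (Arc V)) (vs us : List V) (w : V)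
    (ws : List V) : Prop :=
  IsShortCycle r vs ∧ IsNoosePath r us w ws ∧
    S = walkArcs (r :: vs ++ [r]) ∪ walkArcs (r :: us ++ w :: ws ++ [w])

/-- The node `s` has out-degree two in the graph `S`. -/
def IsSplittingNode (S : Set (Arc V)) (s : V) : Prop := {e ∈ S | e.tail = s}.ncard = 2

/-- In `S`, the cycle with the nodes `C` is linked to the cycle with the nodes `D` by a path
`s → ms → t` that starts in a splitting node `s` on `C`, ends in a node `t` on `D`, and whose
inner nodes `ms` are distinct and lie on neither cycle. The path has `ms.length + 1` arcs. -/
def IsLink (S : Set (Arc V)) (C D : List V) (ms : List V) : Prop :=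
  ∃ s ∈ C, ∃ t ∈ D, IsSplittingNode S s ∧ ms.Nodup ∧ (∀ m ∈ ms, m ∉ C ∧ m ∉ D) ∧
    (s :: ms ++ [t]).IsChain (fun a b => ∃ e ∈ S, e.tail = a ∧ e.head = b)

/-- Type 1: every node has in-degree at least one, the short cycle and the noose cycle are
node-disjoint, and one arc connects the splitting node to a node of the noose cycle. -/
def IsType1 [Fintype V] (r : V) (S : Set (Arc V)) : Prop :=
  EveryInDegreePos S ∧ ∃ vs us w ws, IsShortCycleUnionNoose r S vs us w ws ∧
    (r :: vs).Disjoint (w :: ws) ∧ IsLink S (r :: vs) (w :: ws) []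

/-- Type 2: every node has in-degree at least one, the short cycle and the noose cycle are
node-disjoint, and they are linked by a path of length at least two from the splitting node to a
node of the noose cycle. -/
def IsType2 [Fintype V] (r : V) (S : Set (Arc V)) : Prop :=
  EveryInDegreePos S ∧ ∃ vs us w ws, IsShortCycleUnionNoose r S vs us w ws ∧
    (r :: vs).Disjoint (w :: ws) ∧ ∃ ms, ms ≠ [] ∧ IsLink S (r :: vs) (w :: ws) ms

/-- Type 3: every node has in-degree at least one, and the short cycle and the noose cycle have at
least one node in common. -/
def IsType3 [Fintype V] (r : V) (S : Set (Arc V)) : Prop :=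
  EveryInDegreePos S ∧ ∃ vs us w ws, IsShortCycleUnionNoose r S vs us w ws ∧
    ∃ v, v ∈ r :: vs ∧ v ∈ w :: ws

end Paths

section Polytope

variable {V : Type*} [Fintype V] [DecidableEq V]

/-- The constraint matrix, with one column for each arc. The row `some i` is the conservation of
discounted flow at node `i` (outflow minus `β` times inflow), and the row `none` is the total
outflow of the root `r`. For a graph `G`, the constraint matrix consists of the columns in `G`. -/
def constraintMatrix (β : ℝ) (r : V) : Matrix (Option V) (Arc V) ℝ :=
  Matrix.of fun i e => match i with
    | some i => (if e.tail = i then 1 else 0) - β * (if e.head = i then 1 else 0)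
    | none => if e.tail = r then 1 else 0

/-- The right-hand side of the constraints: `1 - β ^ n` for the flow at the root, `0` for the flow
at the other nodes, and `1` for the outflow of the root. -/
def constraintVector (β : ℝ) (r : V) : Option V → ℝ
  | some i => if i = r then 1 - β ^ Fintype.card V else 0
  | none => 1

/-- The polytope `H_β(G) ⊆ ℝ^G`. A vector in `ℝ^G` is represented by its extension by zero to all
arcs of the complete graph. -/
def hPolytope (β : ℝ) (r : V) (G : Set (Arc V)) : Set (Arc V → ℝ) :=
  {x | (∀ e ∉ G, x e = 0) ∧
    constraintMatrix β r *ᵥ x = constraintVector β r ∧ ∀ e, 0 ≤ x e}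

/-- `B` is a feasible basis of `H_β(G)` (there are `n + 1` basic variables, the corresponding
columns are linearly independent), and `x` is the extreme point given by `B`: the components outside
`B` are zero, so that those in `B` are the components of `A_B⁻¹ b`. -/
def IsFeasibleBasisFor (β : ℝ) (r : V) (G : Set (Arc V)) (B : Finset (Arc V)) (x : Arc V → ℝ) :
    Prop :=
  (B : Set (Arc V)) ⊆ G ∧ B.card = Fintype.card V + 1 ∧
    LinearIndepOn ℝ (constraintMatrix β r).col (B : Set (Arc V)) ∧
    x ∈ hPolytope β r G ∧ ∀ e ∉ B, x e = 0

/-- `B` is a feasible basis of `H_β(G)`. -/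
def IsFeasibleBasis (β : ℝ) (r : V) (G : Set (Arc V)) (B : Finset (Arc V)) : Prop :=
  ∃ x, IsFeasibleBasisFor β r G B x

/-- `x` is an extreme point of `H_β(G)`: a basic feasible solution. -/
def IsExtremePoint (β : ℝ) (r : V) (G : Set (Arc V)) (x : Arc V → ℝ) : Prop :=
  ∃ B, IsFeasibleBasisFor β r G B x

/-- The arc set of the support of `x`. -/
def supportArcs (x : Arc V → ℝ) : Set (Arc V) := {e | 0 < x e}

/-- A Hamiltonian extreme point: its positive coordinates trace out a Hamiltonian cycle. -/
def IsHamiltonianPoint (β : ℝ) (r : V) (G : Set (Arc V)) (x : Arc V → ℝ) : Prop :=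
  IsExtremePoint β r G x ∧ IsHamiltonianCycle r (supportArcs x)

/-- A non-Hamiltonian extreme point whose support has the property `T`. -/
def IsNonHamiltonianPoint (T : Set (Arc V) → Prop) (β : ℝ) (r : V) (G : Set (Arc V))
    (x : Arc V → ℝ) : Prop :=
  IsExtremePoint β r G x ∧ ¬ IsHamiltonianCycle r (supportArcs x) ∧ T (supportArcs x)

/-- A Hamiltonian basis: a feasible basis that contains the support of a Hamiltonian extreme
point. -/
def IsHamiltonianBasis (β : ℝ) (r : V) (G : Set (Arc V)) (B : Finset (Arc V)) : Prop :=
  IsFeasibleBasis β r G B ∧ ∃ x, IsHamiltonianPoint β r G x ∧ supportArcs x ⊆ B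

/-- A non-Hamiltonian basis of type `T`: a feasible basis that contains the support of a
non-Hamiltonian extreme point of type `T`. -/
def IsNonHamiltonianBasis (T : Set (Arc V) → Prop) (β : ℝ) (r : V) (G : Set (Arc V))
    (B : Finset (Arc V)) : Prop :=
  IsFeasibleBasis β r G B ∧ ∃ x, IsNonHamiltonianPoint T β r G x ∧ supportArcs x ⊆ B

/-- The law of the directed binomial random graph: every ordered pair of distinct nodes is,
independently, an arc with probability `p`. -/
noncomputable def binomialDigraph (V : Type*) (p : unitInterval) : Measure (Set (Arc V)) :=
  setBernoulli Set.univ p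

/-- The expected number of arc sets `B` with the property `P G B`, where `G` is a directed binomial
random graph. -/
noncomputable def expectedNumber (p : unitInterval)
    (P : Set (Arc V) → Finset (Arc V) → Prop) : ℝ :=
  ∫ G, ({B | P G B}.ncard : ℝ) ∂(binomialDigraph V p)

end Polytope

/-! Whether `B` is a feasible basis, and which extreme point it has, depends on the graph only
through `B ⊆ G`. By linearity of expectation each expected number is therefore a count in the
complete digraph times `p ^ (n + 1)`, and the theorem becomes a count of bases by the support of
their extreme point.

The tool for the count is the discounted walk. A fixed-point-free map `f` sends the root along `r, f
r, f (f r), …`; its discounted flow satisfies the node equations with a unit source at `r`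
(`mulVec_flow`), and is the only such flow on the arcs of `f` (`eq_zero_of_conservation`). The
outflow of the root is `1 / (1 - β ^ m)` if the first return is at time `m`, and `1` if there is
none. Two maps that differ at a single node have `n + 1` arcs together, and their columns are
independent as soon as the two root outflows differ (`linearIndepOn_pairGraph`).

Hamiltonian bases: the scaled flow of the cycle has `n` positive arcs, and any further arc completes
a basis, because redirecting one node destroys injectivity and changes the outflow of the root. This
gives `(n - 1)!` cycles times `n (n - 1) - n` extra arcs.

Types 1 to 3: a spanning union of a short cycle and a noose path with at most `n + 1` arcs branches
exactly once (`exists_config`). It is coded by an ordering `σ` of the nodes starting at the root,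
the cycle length `m`, the splitting position `s` and the position `w` where the noose closes. It has
exactly `n + 1` arcs and is itself a basis with full support. The types are `w = m`, `m < w` and `w
≤ s`; the code is unique (`configGraph_inj`), so it remains to sum over `m`, `s`, `w`.

Type 4: the support `r → a → r`, `r → a → b → a` has four arcs and leaves a node isolated when `n ≥
4`. Every arbitrarily oriented forest on the other `n - 3` nodes, rooted in `{r, a, b}`, completes
it to a basis. There are `3 n ^ (n - 4)` such forests by a determinant (`card_isAcyclicMap`) and `2
^ (n - 3)` orientations, which exceeds the claimed bound. -/

section Expectation

/-! ### Reduction of the expectation to counting in the complete digraph -/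

variable {V : Type*}

lemma binomialDigraph_real_superset (p : unitInterval) (B : Finset (Arc V)) :
    (binomialDigraph V p).real {G | (B : Set (Arc V)) ⊆ G} = (p : ℝ) ^ B.card := by
  -- Arc sets are encoded by predicates, so the event is a cylinder set of an infinite product
  -- measure.
  have h1 : (fun q : Arc V → Prop ↦ {i | q i}) ⁻¹' {G | (B : Set (Arc V)) ⊆ G} =
      Set.pi (B : Set (Arc V)) (fun _ => {True}) := by
    ext q
    simp [Set.subset_def, Set.mem_pi]
  rw [measureReal_def, binomialDigraph, setBernoulli_apply', h1, Measure.infinitePi_pi]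
  · simp
  · simp

lemma supportArcs_subset_of_eq_zero {B : Finset (Arc V)} {x : Arc V → ℝ}
    (h : ∀ e ∉ B, x e = 0) : supportArcs x ⊆ B := by
  intro e he
  by_contra h'
  exact (ne_of_gt (show 0 < x e from he)) (h e h')

variable [Fintype V] [DecidableEq V]

/-- Linearity of expectation: the count is a sum over `B` of the indicators of `B ⊆ G`. -/
lemma expectedNumber_eq (p : unitInterval) {P : Set (Arc V) → Finset (Arc V) → Prop}
    {Q : Finset (Arc V) → Prop} {k : ℕ} (hPQ : ∀ G B, P G B ↔ (B : Set (Arc V)) ⊆ G ∧ Q B)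
    (hQ : ∀ B, Q B → B.card = k) :
    expectedNumber p P = ({B | Q B}.ncard : ℝ) * (p : ℝ) ^ k := by
  classical
  have h1 : ∀ G : Set (Arc V), ({B | P G B}.ncard : ℝ) =
      ∑ B ∈ Finset.univ.filter Q, Set.indicator {G | (B : Set (Arc V)) ⊆ G} (fun _ => (1 : ℝ)) G := by
    intro G
    have : {B | P G B} = (((Finset.univ.filter Q).filter (fun B => (B : Set (Arc V)) ⊆ G) :
        Finset (Finset (Arc V))) : Set (Finset (Arc V))) := by
      ext B; simp [hPQ, and_comm]
    rw [this, Set.ncard_coe_finset, Finset.card_filter]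
    push_cast
    refine Finset.sum_congr rfl fun B _ => ?_
    simp [Set.indicator_apply]
  have hm : ∀ B : Finset (Arc V), MeasurableSet {G : Set (Arc V) | (B : Set (Arc V)) ⊆ G} :=
    fun B => .of_discrete
  have : IsProbabilityMeasure (binomialDigraph V p) := by
    unfold binomialDigraph; infer_instance
  unfold expectedNumber
  simp_rw [h1]
  rw [integral_finsetSum _ fun B _ => (integrable_const (1 : ℝ)).indicator (hm B)]
  have h2 : ∀ B ∈ Finset.univ.filter Q,
      ∫ G, Set.indicator {G | (B : Set (Arc V)) ⊆ G} (fun _ => (1 : ℝ)) G ∂(binomialDigraph V p) =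
        (p : ℝ) ^ k := by
    intro B hB
    rw [integral_indicator_const _ (hm B), binomialDigraph_real_superset,
      hQ B (Finset.mem_filter.1 hB).2]
    simp
  rw [Finset.sum_congr rfl h2, Finset.sum_const, nsmul_eq_mul]
  congr 2
  rw [← Set.ncard_coe_finset]
  simp

/-- Neither the columns indexed by `B` nor the right-hand side involve `G`. This supplies the
splitting needed in `expectedNumber_eq`. -/
lemma isFeasibleBasisFor_iff {β : ℝ} {r : V} {G : Set (Arc V)} {B : Finset (Arc V)}
    {x : Arc V → ℝ} : IsFeasibleBasisFor β r G B x ↔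
      (B : Set (Arc V)) ⊆ G ∧ IsFeasibleBasisFor β r Set.univ B x := by
  constructor
  · rintro ⟨h1, h2, h3, ⟨-, h4, h5⟩, h6⟩
    exact ⟨h1, Set.subset_univ _, h2, h3, ⟨by simp, h4, h5⟩, h6⟩
  · rintro ⟨h1, -, h2, h3, ⟨-, h4, h5⟩, h6⟩
    exact ⟨h1, h2, h3, ⟨fun e he => h6 e fun h => he (h1 h), h4, h5⟩, h6⟩

lemma eq_zero_of_supportArcs_subset {β : ℝ} {r : V} {G : Set (Arc V)} {B : Finset (Arc V)}
    {x : Arc V → ℝ} (hx : x ∈ hPolytope β r G) (h : supportArcs x ⊆ B) (e : Arc V) (he : e ∉ B) :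
    x e = 0 :=
  le_antisymm (not_lt.1 fun h' => he (h h')) (hx.2.2 e)

/-- A feasible basis contains the support of an extreme point if and only if this is its own
extreme point. -/
lemma isFeasibleBasis_and_exists_iff {β : ℝ} {r : V} {G : Set (Arc V)} {B : Finset (Arc V)}
    {T : Set (Arc V) → Prop} :
    (IsFeasibleBasis β r G B ∧ ∃ x, (IsExtremePoint β r G x ∧ T (supportArcs x)) ∧
      supportArcs x ⊆ B) ↔
      (B : Set (Arc V)) ⊆ G ∧ ∃ x, IsFeasibleBasisFor β r Set.univ B x ∧ T (supportArcs x) := by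
  constructor
  · rintro ⟨⟨y, hy⟩, x, ⟨⟨B', hB'⟩, hT⟩, hs⟩
    -- The point `x` comes with a basis `B'` of its own; since it vanishes outside `B`, it is also
    -- the basic solution of `B`.
    refine ⟨hy.1, x, (isFeasibleBasisFor_iff.1 ⟨hy.1, hy.2.1, hy.2.2.1, hB'.2.2.2.1, ?_⟩).2, hT⟩
    exact eq_zero_of_supportArcs_subset hB'.2.2.2.1 hs
  · rintro ⟨hG, x, hx, hT⟩
    have hx' := isFeasibleBasisFor_iff.2 ⟨hG, hx⟩
    exact ⟨⟨x, hx'⟩, x, ⟨⟨B, hx'⟩, hT⟩, supportArcs_subset_of_eq_zero hx.2.2.2.2⟩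

/-- The number of feasible bases of the complete digraph whose extreme point has a support with the
property `T`. -/
noncomputable def numBases (β : ℝ) (r : V) (T : Set (Arc V) → Prop) : ℕ :=
  {B : Finset (Arc V) | ∃ x, IsFeasibleBasisFor β r Set.univ B x ∧ T (supportArcs x)}.ncard

lemma expectedNumber_isHamiltonianBasis (p : unitInterval) (β : ℝ) (r : V) :
    expectedNumber p (IsHamiltonianBasis β r) =
      numBases β r (IsHamiltonianCycle r) * (p : ℝ) ^ (Fintype.card V + 1) :=
  expectedNumber_eq p (fun _ _ => isFeasibleBasis_and_exists_iff) fun _ ⟨_, hx, _⟩ => hx.2.1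

lemma expectedNumber_isNonHamiltonianBasis (p : unitInterval) (β : ℝ) (r : V)
    (T : Set (Arc V) → Prop) :
    expectedNumber p (IsNonHamiltonianBasis T β r) =
      numBases β r (fun S => ¬ IsHamiltonianCycle r S ∧ T S) *
        (p : ℝ) ^ (Fintype.card V + 1) :=
  expectedNumber_eq p (fun _ _ => isFeasibleBasis_and_exists_iff
    (T := fun S => ¬ IsHamiltonianCycle r S ∧ T S)) fun _ ⟨_, hx, _⟩ => hx.2.1

end Expectation

/-! ### Discounted flows of deterministic walks -/

section DiscountedFlow

variable {V : Type*}

/-- The arc from `v` to `f v`. -/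
def arcTo (f : V → V) (hf : ∀ v, f v ≠ v) (v : V) : Arc V := ⟨(v, f v), (hf v).symm⟩

@[simp] lemma arcTo_tail (f : V → V) (hf : ∀ v, f v ≠ v) (v : V) : (arcTo f hf v).tail = v := rfl

@[simp] lemma arcTo_head (f : V → V) (hf : ∀ v, f v ≠ v) (v : V) : (arcTo f hf v).head = f v := rfl

lemma Arc.ext' {e e' : Arc V} (h1 : e.tail = e'.tail) (h2 : e.head = e'.head) : e = e' :=
  Subtype.ext (Prod.ext h1 h2)

lemma Arc.tail_ne_head (e : Arc V) : e.tail ≠ e.head := e.2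

variable [DecidableEq V]

/-- The discounted expected number of visits to `v` of the walk `r, f r, f (f r), …`. -/
noncomputable def occupation (β : ℝ) (r : V) (f : V → V) (v : V) : ℝ :=
  ∑' t : ℕ, if f^[t] r = v then β ^ t else 0

/-- The discounted number of traversals of an arc by the walk `r, f r, f (f r), …`. -/
noncomputable def flow (β : ℝ) (r : V) (f : V → V) (e : Arc V) : ℝ :=
  if e.head = f e.tail then occupation β r f e.tail else 0

variable {β : ℝ} {r : V} {f : V → V}

lemma summable_occupation (h0 : 0 < β) (h1 : β < 1) (q : ℕ → Prop) [DecidablePred q] :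
    Summable fun t : ℕ => if q t then β ^ t else 0 := by
  refine Summable.of_nonneg_of_le (fun t => ?_) (fun t => ?_)
    (summable_geometric_of_lt_one h0.le h1)
  · split_ifs <;> positivity
  · split_ifs
    · exact le_rfl
    · positivity

lemma occupation_nonneg (h0 : 0 < β) (v : V) : 0 ≤ occupation β r f v :=
  tsum_nonneg fun t => by split_ifs <;> positivity

lemma occupation_pos (h0 : 0 < β) (h1 : β < 1) {v : V} {t : ℕ} (h : f^[t] r = v) :
    0 < occupation β r f v := by
  refine (summable_occupation h0 h1 _).tsum_pos (fun t => ?_) t ?_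
  · split_ifs <;> positivity
  · rw [if_pos h]; positivity

lemma occupation_eq_zero {v : V} (h : ∀ t, f^[t] r ≠ v) : occupation β r f v = 0 := by
  simp [occupation, h]

lemma occupation_root_of_ne (h : ∀ t, f^[t + 1] r ≠ r) : occupation β r f r = 1 := by
  unfold occupation
  rw [tsum_eq_single 0]
  · simp
  · intro t ht
    obtain ⟨k, rfl⟩ := Nat.exists_eq_succ_of_ne_zero ht
    exact if_neg (h k)

/-- From time `m` on the walk repeats itself with discount `β ^ m`, so the occupation `z` of the
root solves `1 + β ^ m * z = z`. -/
lemma occupation_root_of_period (h0 : 0 < β) (h1 : β < 1) {m : ℕ} (hm0 : 0 < m)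
    (hm : f^[m] r = r) (h : ∀ t, 0 < t → t < m → f^[t] r ≠ r) :
    occupation β r f r = 1 / (1 - β ^ m) := by
  have hs := summable_occupation h0 h1 (fun t => f^[t] r = r)
  have h2 := hs.sum_add_tsum_nat_add m
  have h3 : ∑ t ∈ Finset.range m, (if f^[t] r = r then β ^ t else 0) = 1 := by
    rw [Finset.sum_eq_single 0]
    · simp
    · intro t ht ht0
      exact if_neg (h t (Nat.pos_of_ne_zero ht0) (Finset.mem_range.1 ht))
    · simp [hm0.ne']
  have h4 : ∑' t, (if f^[t + m] r = r then β ^ (t + m) else 0) = β ^ m * occupation β r f r := by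
    unfold occupation
    rw [← tsum_mul_left]
    congr 1; ext t
    rw [Function.iterate_add_apply, hm, pow_add]
    split_ifs <;> ring
  rw [h3, h4] at h2
  change 1 + β ^ m * occupation β r f r = occupation β r f r at h2
  have h5 : β ^ m < 1 := pow_lt_one₀ h0.le h1 hm0.ne'
  field_simp [(sub_pos.2 h5).ne']
  linarith

variable [Fintype V]

/-- Time `0` is split off; every later visit to `v` follows, one step before, a visit to some `u`
with `f u = v`. -/
lemma occupation_eq (h0 : 0 < β) (h1 : β < 1) (v : V) :
    occupation β r f v = (if v = r then 1 else 0) +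
      β * ∑ u, if f u = v then occupation β r f u else 0 := by
  have hs := summable_occupation h0 h1 (fun t => f^[t] r = v)
  have h2 := hs.sum_add_tsum_nat_add 1
  rw [show occupation β r f v = ∑' t : ℕ, if f^[t] r = v then β ^ t else 0 from rfl, ← h2]
  congr 1
  · simp [eq_comm]
  · have h3 : ∀ u, (if f u = v then occupation β r f u else 0) =
        ∑' t, if f u = v ∧ f^[t] r = u then β ^ t else 0 := by
      intro u
      by_cases h : f u = v <;> simp [h, occupation]
    simp_rw [h3]
    rw [← Summable.tsum_finsetSum fun u _ => summable_occupation h0 h1 _, ← tsum_mul_left]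
    congr 1; ext t
    rw [Function.iterate_succ_apply']
    rw [Finset.sum_eq_single (f^[t] r)]
    · simp only [and_true]
      split_ifs <;> ring
    · intro u _ hu
      exact if_neg fun h => hu h.2.symm
    · simp

lemma mulVec_some (y : Arc V → ℝ) (i : V) :
    (constraintMatrix β r *ᵥ y) (some i) =
      (∑ e, if e.tail = i then y e else 0) - β * ∑ e, if e.head = i then y e else 0 := by
  simp only [Matrix.mulVec, dotProduct, constraintMatrix, Matrix.of_apply, Finset.mul_sum,
    ← Finset.sum_sub_distrib]
  refine Finset.sum_congr rfl fun e _ => ?_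
  split_ifs <;> ring

lemma mulVec_none (y : Arc V → ℝ) :
    (constraintMatrix β r *ᵥ y) none = ∑ e, if e.tail = r then y e else 0 := by
  simp only [Matrix.mulVec, dotProduct, constraintMatrix, Matrix.of_apply]
  refine Finset.sum_congr rfl fun e _ => ?_
  split_ifs <;> ring

lemma sum_eq_sum_arcTo (hf : ∀ v, f v ≠ v) (ψ : Arc V → ℝ)
    (h : ∀ e : Arc V, e.head ≠ f e.tail → ψ e = 0) : ∑ e, ψ e = ∑ v, ψ (arcTo f hf v) := by
  symm
  refine Finset.sum_of_injOn (arcTo f hf) ?_ (by simp) ?_ (by simp)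
  · intro u _ v _ huv
    exact congrArg Arc.tail huv
  · intro e _ he
    refine h e fun h' => he ?_
    exact ⟨e.tail, by simp, Arc.ext' rfl h'.symm⟩

/-- The outflow of a node is its occupation and the inflow is the total occupation of its preimages,
so the node rows are `occupation_eq`. -/
lemma mulVec_flow (h0 : 0 < β) (h1 : β < 1) (hf : ∀ v, f v ≠ v) :
    (∀ i, (constraintMatrix β r *ᵥ flow β r f) (some i) = if i = r then 1 else 0) ∧
      (constraintMatrix β r *ᵥ flow β r f) none = occupation β r f r := by
  have hz : ∀ q : Arc V → Prop, ∀ [DecidablePred q], ∀ e : Arc V, e.head ≠ f e.tail →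
      (if q e then flow β r f e else 0) = 0 := by
    intro q _ e he
    simp [flow, he]
  constructor
  · intro i
    rw [mulVec_some, sum_eq_sum_arcTo hf _ (hz _), sum_eq_sum_arcTo hf _ (hz _)]
    have := occupation_eq (r := r) (f := f) h0 h1 i
    simp only [arcTo_tail, arcTo_head, flow, if_true]
    rw [Finset.sum_ite_eq' Finset.univ i]
    simp [this]
  · rw [mulVec_none, sum_eq_sum_arcTo hf _ (hz _)]
    simp [flow]

/-- Conservation says that `y`, read as a function of the tail, is `β` times its push-forward under
`f`. Push-forward does not increase the `ℓ¹` norm, so this norm is at most `β` times itself. -/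
lemma eq_zero_of_conservation (h0 : 0 < β) (h1 : β < 1) (hf : ∀ v, f v ≠ v) {y : Arc V → ℝ}
    (hy : ∀ e : Arc V, e.head ≠ f e.tail → y e = 0)
    (h : ∀ i, (constraintMatrix β r *ᵥ y) (some i) = 0) : y = 0 := by
  set g : V → ℝ := fun v => y (arcTo f hf v) with hg
  have hz : ∀ q : Arc V → Prop, ∀ [DecidablePred q], ∀ e : Arc V, e.head ≠ f e.tail →
      (if q e then y e else 0) = 0 := by
    intro q _ e he
    simp [hy e he]
  have hrow : ∀ i, g i = β * ∑ v, if f v = i then g v else 0 := by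
    intro i
    have := h i
    rw [mulVec_some, sum_eq_sum_arcTo hf _ (hz _), sum_eq_sum_arcTo hf _ (hz _)] at this
    have h2 : (∑ v, if v = i then g v else 0) - β * ∑ v, (if f v = i then g v else 0) = 0 := this
    rw [Finset.sum_ite_eq' Finset.univ i, if_pos (Finset.mem_univ i)] at h2
    exact sub_eq_zero.1 h2
  have hle : ∑ i, |g i| ≤ β * ∑ v, |g v| := by
    calc ∑ i, |g i| ≤ ∑ i, β * ∑ v, (if f v = i then |g v| else 0) := by
          refine Finset.sum_le_sum fun i _ => ?_
          rw [hrow i, abs_mul, abs_of_pos h0]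
          refine mul_le_mul_of_nonneg_left ((Finset.abs_sum_le_sum_abs _ _).trans ?_) h0.le
          refine Finset.sum_le_sum fun v _ => ?_
          split_ifs <;> simp
      _ = β * ∑ v, |g v| := by
          rw [← Finset.mul_sum, Finset.sum_comm]
          simp
  have hnn : 0 ≤ ∑ v, |g v| := Finset.sum_nonneg fun _ _ => abs_nonneg _
  have hzero : ∑ v, |g v| = 0 := by nlinarith
  ext e
  by_cases he : e.head = f e.tail
  · have := (Finset.sum_eq_zero_iff_of_nonneg fun _ _ => abs_nonneg _).1 hzero e.tail
      (Finset.mem_univ _)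
    rw [abs_eq_zero] at this
    have h2 : y (arcTo f hf e.tail) = 0 := this
    rwa [show arcTo f hf e.tail = e from Arc.ext' rfl he.symm] at h2
  · exact hy e he

lemma linearIndepOn_col_iff {ι κ : Type*} [Fintype κ] (A : Matrix ι κ ℝ) (B : Finset κ) :
    LinearIndepOn ℝ A.col (B : Set κ) ↔ ∀ y : κ → ℝ, (∀ e ∉ B, y e = 0) → A *ᵥ y = 0 → y = 0 := by
  classical
  rw [linearIndepOn_finset_iff]
  have key : ∀ y : κ → ℝ, (∀ e ∉ B, y e = 0) → A *ᵥ y = ∑ e ∈ B, y e • A.col e := by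
    intro y hy
    ext i
    rw [Finset.sum_apply, Matrix.mulVec, dotProduct]
    symm
    refine (Finset.sum_subset (Finset.subset_univ B) fun e _ he => ?_).trans
      (Finset.sum_congr rfl fun e _ => ?_)
    · simp [hy e he]
    · simp [mul_comm]
  constructor
  · intro h y hy hA
    ext e
    by_cases he : e ∈ B
    · exact h y (by rw [← key y hy, hA]) e he
    · exact hy e he
  · intro h g hg e he
    have := h (fun e => if e ∈ B then g e else 0) (fun e he => if_neg he) (by
      rw [key _ fun e he => if_neg he, ← hg]
      exact Finset.sum_congr rfl fun e he => by simp [he])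
    simpa [he] using congrFun this e

/-- The arcs `v → f v` and `v → f' v`. -/
def pairGraph (f f' : V → V) : Finset (Arc V) :=
  Finset.univ.filter fun e => e.head = f e.tail ∨ e.head = f' e.tail

@[simp] lemma mem_pairGraph {f f' : V → V} {e : Arc V} :
    e ∈ pairGraph f f' ↔ e.head = f e.tail ∨ e.head = f' e.tail := by simp [pairGraph]

/-- On these arcs the node rows have a one-dimensional kernel, spanned by the difference `d` of the
two flows: subtracting a multiple of `d` removes the one arc outside the graph of `f`, and
`eq_zero_of_conservation` applies. The last row takes the value `occupation β r f' r - occupation β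
r f r` on `d`, which is nonzero. -/
lemma linearIndepOn_pairGraph (h0 : 0 < β) (h1 : β < 1) {f f' : V → V} {s : V}
    (hf : ∀ v, f v ≠ v) (hf' : ∀ v, f' v ≠ v) (hs : ∀ v, v ≠ s → f v = f' v)
    (hocc : occupation β r f r ≠ occupation β r f' r) :
    LinearIndepOn ℝ (constraintMatrix β r).col (pairGraph f f' : Set (Arc V)) := by
  rw [linearIndepOn_col_iff]
  intro y hy hA
  set a : Arc V := arcTo f' hf' s with ha
  have hfl := mulVec_flow (r := r) h0 h1 hf
  have hfl' := mulVec_flow (r := r) h0 h1 hf'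
  have hss : f s ≠ f' s := by
    intro h
    have : f = f' := by
      ext v
      by_cases hv : v = s
      · rw [hv, h]
      · exact hs v hv
    exact hocc (by rw [this])
  have hoff : ∀ e : Arc V, e.head ≠ f e.tail → e ≠ a → e.head ≠ f' e.tail := by
    intro e he hea h
    by_cases het : e.tail = s
    · exact hea (Arc.ext' het (by rw [h, het]; rfl))
    · exact he (by rw [h, hs _ het])
  set d : Arc V → ℝ := flow β r f' - flow β r f with hd
  have hdnode : ∀ i, (constraintMatrix β r *ᵥ d) (some i) = 0 := by
    intro i
    rw [hd, Matrix.mulVec_sub, Pi.sub_apply, hfl.1, hfl'.1, sub_self]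
  have hda : d a ≠ 0 := by
    intro hda
    have : d = 0 := by
      refine eq_zero_of_conservation (r := r) h0 h1 hf (fun e he => ?_) hdnode
      by_cases hea : e = a
      · rw [hea, hda]
      · simp [hd, flow, he, hoff e he hea]
    have h2 := hfl'.2
    rw [show flow β r f' = flow β r f from sub_eq_zero.1 this, hfl.2] at h2
    exact hocc h2
  set c : ℝ := y a / d a with hc
  have hyc : y - c • d = 0 := by
    refine eq_zero_of_conservation (r := r) h0 h1 hf (fun e he => ?_) (fun i => ?_)
    · by_cases hea : e = a
      · rw [hea]
        simp [hc, hda]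
      · have h2 := hoff e he hea
        have h3 : y e = 0 := hy e (by simp [he, h2])
        simp [hd, flow, he, h2, h3]
    · rw [Matrix.mulVec_sub, Matrix.mulVec_smul, hA]
      simp [hdnode]
  have hy' : y = c • d := sub_eq_zero.1 hyc
  have h2 := congrFun hA none
  rw [hy', Matrix.mulVec_smul, Pi.smul_apply, hd, Matrix.mulVec_sub, Pi.sub_apply, hfl.2, hfl'.2]
    at h2
  have hc0 : c = 0 := by
    rcases mul_eq_zero.1 h2 with h | h
    · exact h
    · exact absurd (sub_eq_zero.1 h).symm hocc
  rw [hy', hc0, zero_smul]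

lemma card_pairGraph {f f' : V → V} {s : V} (hf : ∀ v, f v ≠ v) (hf' : ∀ v, f' v ≠ v)
    (hs : ∀ v, v ≠ s → f v = f' v) (hss : f s ≠ f' s) :
    (pairGraph f f').card = Fintype.card V + 1 := by
  have : pairGraph f f' = insert (arcTo f' hf' s) (Finset.univ.image (arcTo f hf)) := by
    ext e
    simp only [mem_pairGraph, Finset.mem_insert, Finset.mem_image, Finset.mem_univ, true_and]
    constructor
    · rintro (h | h)
      · exact Or.inr ⟨e.tail, Arc.ext' rfl h.symm⟩
      · by_cases het : e.tail = s
        · exact Or.inl (Arc.ext' het (by rw [h, het]; rfl))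
        · exact Or.inr ⟨e.tail, Arc.ext' rfl (by rw [h, arcTo_head, hs _ het])⟩
    · rintro (rfl | ⟨v, rfl⟩) <;> simp
  rw [this, Finset.card_insert_of_notMem, Finset.card_image_of_injective, Finset.card_univ]
  · intro u v huv
    exact congrArg Arc.tail huv
  · simp only [Finset.mem_image, Finset.mem_univ, true_and, not_exists]
    intro v hv
    have h2 : v = s := congrArg Arc.tail hv
    subst h2
    exact hss (congrArg Arc.head hv)

lemma IsFeasibleBasisFor.unique {G : Set (Arc V)} {B : Finset (Arc V)} {x y : Arc V → ℝ}
    (hx : IsFeasibleBasisFor β r G B x) (hy : IsFeasibleBasisFor β r G B y) : x = y := by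
  have := (linearIndepOn_col_iff _ _).1 hx.2.2.1 (x - y)
    (fun e he => by simp [hx.2.2.2.2 e he, hy.2.2.2.2 e he])
    (by rw [Matrix.mulVec_sub, hx.2.2.2.1.2.1, hy.2.2.2.1.2.1, sub_self])
  exact sub_eq_zero.1 this

lemma mem_hPolytope_flow (h0 : 0 < β) (h1 : β < 1) (hf : ∀ v, f v ≠ v) [Nonempty V]
    (hocc : occupation β r f r = 1 / (1 - β ^ Fintype.card V)) :
    (1 - β ^ Fintype.card V) • flow β r f ∈ hPolytope β r Set.univ := by
  have hfl := mulVec_flow (r := r) h0 h1 hf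
  have hn : 0 < 1 - β ^ Fintype.card V :=
    sub_pos.2 (pow_lt_one₀ h0.le h1 Fintype.card_ne_zero)
  refine ⟨by simp, ?_, fun e => ?_⟩
  · ext i
    rw [Matrix.mulVec_smul, Pi.smul_apply]
    cases i with
    | none => rw [hfl.2, hocc]; simp [constraintVector, hn.ne']
    | some i => rw [hfl.1]; simp [constraintVector]
  · refine mul_nonneg hn.le ?_
    unfold flow
    split_ifs
    · exact occupation_nonneg h0 _
    · exact le_rfl

/-- A convex combination of the discounted flow of a short cycle with a discounted flow that never
returns to the root lies in the polytope. -/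
lemma exists_mem_hPolytope_supportArcs (h0 : 0 < β) (h1 : β < 1) {f f' : V → V}
    (hf : ∀ v, f v ≠ v) (hf' : ∀ v, f' v ≠ v) {m : ℕ} (hm0 : 0 < m) (hm : m < Fintype.card V)
    (hocc : occupation β r f r = 1 / (1 - β ^ m)) (hocc' : occupation β r f' r = 1) :
    ∃ x ∈ hPolytope β r Set.univ, supportArcs x =
      {e | (e.head = f e.tail ∧ ∃ t, f^[t] r = e.tail) ∨
        (e.head = f' e.tail ∧ ∃ t, f'^[t] r = e.tail)} := by
  have hfl := mulVec_flow (r := r) h0 h1 hf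
  have hfl' := mulVec_flow (r := r) h0 h1 hf'
  set n := Fintype.card V with hn
  have hbn : 0 < β ^ n := by positivity
  have hbm : β ^ n < β ^ m := pow_lt_pow_right_of_lt_one₀ h0 h1 hm
  have hbm1 : β ^ m < 1 := pow_lt_one₀ h0.le h1 hm0.ne'
  -- The weights solve `c + d = 1 - β ^ n` (the source at the root) and `c / (1 - β ^ m) + d = 1`
  -- (the outflow of the root). Hence `d = 1 - β ^ (n - m)`, positive because `m < n`.
  set c : ℝ := β ^ n * (1 - β ^ m) / β ^ m with hc
  set d : ℝ := (1 - β ^ n) - c with hd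
  have hc0 : 0 < c := div_pos (mul_pos hbn (by linarith)) (by linarith)
  have hd0 : 0 < d := by
    have : d = (β ^ m - β ^ n) / β ^ m := by
      rw [hd, hc]; field_simp; ring
    rw [this]
    exact div_pos (by linarith) (by linarith)
  have hnn : ∀ g : V → V, ∀ e, 0 ≤ flow β r g e := by
    intro g e
    unfold flow
    split_ifs
    · exact occupation_nonneg h0 _
    · exact le_rfl
  have hpos : ∀ g : V → V, ∀ e : Arc V, 0 < flow β r g e ↔
      (e.head = g e.tail ∧ ∃ t, g^[t] r = e.tail) := by
    intro g e
    unfold flow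
    constructor
    · intro h
      split_ifs at h with h2
      · refine ⟨h2, ?_⟩
        by_contra h3
        push Not at h3
        rw [occupation_eq_zero h3] at h
        exact lt_irrefl _ h
      · exact absurd h (lt_irrefl _)
    · rintro ⟨h2, t, ht⟩
      rw [if_pos h2]
      exact occupation_pos h0 h1 ht
  refine ⟨c • flow β r f + d • flow β r f', ⟨by simp, ?_, fun e => ?_⟩, ?_⟩
  · ext i
    rw [Matrix.mulVec_add, Matrix.mulVec_smul, Matrix.mulVec_smul, Pi.add_apply, Pi.smul_apply,
      Pi.smul_apply]
    cases i with
    | none =>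
      rw [hfl.2, hocc, hfl'.2, hocc']
      simp only [constraintVector, smul_eq_mul, hd, hc]
      have : 1 - β ^ m ≠ 0 := by linarith
      field_simp
      ring
    | some i =>
      rw [hfl.1, hfl'.1]
      simp only [constraintVector, smul_eq_mul, hd]
      split_ifs <;> ring
  · exact add_nonneg (mul_nonneg hc0.le (hnn f e)) (mul_nonneg hd0.le (hnn f' e))
  · ext e
    simp only [supportArcs, Set.mem_ofPred_eq, ← hpos, Pi.add_apply, Pi.smul_apply, smul_eq_mul]
    constructor
    · intro h
      by_contra h2
      push Not at h2
      have h3 := le_antisymm h2.1 (hnn f e)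
      have h4 := le_antisymm h2.2 (hnn f' e)
      rw [h3, h4] at h
      simp at h
    · rintro (h | h)
      · exact add_pos_of_pos_of_nonneg (mul_pos hc0 h) (mul_nonneg hd0.le (hnn f' e))
      · exact add_pos_of_nonneg_of_pos (mul_nonneg hc0.le (hnn f e)) (mul_pos hd0 h)

end DiscountedFlow

/-! ### Short cycle plus noose path, coded by an ordering and three positions -/

section Configuration

variable {n : ℕ} [NeZero n]

/-- The node at position `k` in the ordering `σ` of the nodes. -/
def nodeAt (σ : Equiv.Perm (Fin n)) (k : ℕ) : Fin n := σ (Fin.ofNat n k)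

lemma nodeAt_inj {σ : Equiv.Perm (Fin n)} {k l : ℕ} (hk : k < n) (hl : l < n) :
    nodeAt σ k = nodeAt σ l ↔ k = l := by
  simp [nodeAt, Fin.ext_iff, Fin.ofNat, Nat.mod_eq_of_lt hk, Nat.mod_eq_of_lt hl]

lemma exists_nodeAt (σ : Equiv.Perm (Fin n)) (v : Fin n) : ∃ k < n, nodeAt σ k = v := by
  refine ⟨(σ.symm v : ℕ), (σ.symm v).2, ?_⟩
  simp [nodeAt]

lemma nodeAt_zero {σ : Equiv.Perm (Fin n)} (h : σ 0 = 0) : nodeAt σ 0 = 0 := by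
  simpa [nodeAt] using h

lemma perm_ext_nodeAt {σ τ : Equiv.Perm (Fin n)} (h : ∀ k < n, nodeAt σ k = nodeAt τ k) :
    σ = τ := by
  ext1 v
  simpa [nodeAt] using h v v.2

/-- The successor of position `k`, when position `m - 1` is followed by the root and the last
position is followed by position `w`. -/
def nextPos (n m w k : ℕ) : ℕ := if k + 1 = m then 0 else if k + 1 = n then w else k + 1

/-- The successor map `nextPos` on the nodes. -/
def cycleMap (σ : Equiv.Perm (Fin n)) (m w : ℕ) (v : Fin n) : Fin n :=
  nodeAt σ (nextPos n m w (σ.symm v))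

/-- The modification of `cycleMap` that branches off from position `s` to position `m`. -/
def nooseMap (σ : Equiv.Perm (Fin n)) (m s w : ℕ) (v : Fin n) : Fin n :=
  if v = nodeAt σ s then nodeAt σ m else cycleMap σ m w v

lemma cycleMap_nodeAt {σ : Equiv.Perm (Fin n)} {m w k : ℕ} (hk : k < n) :
    cycleMap σ m w (nodeAt σ k) = nodeAt σ (nextPos n m w k) := by
  simp [cycleMap, nodeAt, Nat.mod_eq_of_lt hk]

lemma nooseMap_nodeAt {σ : Equiv.Perm (Fin n)} {m s w k : ℕ} (hk : k < n) (hs : s < n) :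
    nooseMap σ m s w (nodeAt σ k) = nodeAt σ (if k = s then m else nextPos n m w k) := by
  by_cases h : k = s
  · simp [nooseMap, h]
  · have : nodeAt σ k ≠ nodeAt σ s := fun h' => h ((nodeAt_inj hk hs).1 h')
    simp [nooseMap, h, this, cycleMap_nodeAt hk]

lemma iterate_nodeAt {σ : Equiv.Perm (Fin n)} {F : Fin n → Fin n} {a K : ℕ}
    (h : ∀ k, a ≤ k → k < a + K → F (nodeAt σ k) = nodeAt σ (k + 1)) {k : ℕ} (hk : k ≤ K) :
    F^[k] (nodeAt σ a) = nodeAt σ (a + k) := by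
  induction k with
  | zero => rfl
  | succ k ih =>
    rw [Function.iterate_succ_apply', ih (by omega), h _ (by omega) (by omega), add_assoc]

/-- The parameters of a graph on `n` nodes that is the union of a short cycle of length `m` and a
noose path which branches off at position `s` and ends at position `w`. -/
structure IsConfig (n m s w : ℕ) : Prop where
  two_le : 2 ≤ m
  lt : m < n
  split_lt : s < m
  -- The noose closes either on its common part with the short cycle or beyond it. Positions
  -- strictly between `s` and `m` are not on the noose path, and `w = n - 1` would be a loop.
  noose : 1 ≤ w ∧ w ≤ s ∨ m ≤ w ∧ w + 2 ≤ n

variable {σ τ : Equiv.Perm (Fin n)} {m s w : ℕ}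

/-- The arcs of the configuration with the parameters `m`, `s`, `w` and the node ordering `σ`. -/
def configGraph (σ : Equiv.Perm (Fin n)) (m s w : ℕ) : Finset (Arc (Fin n)) :=
  pairGraph (cycleMap σ m w) (nooseMap σ m s w)

lemma cycleMap_ne (hm : 2 ≤ m) (hw : w + 2 ≤ n) (v : Fin n) :
    cycleMap σ m w v ≠ v := by
  obtain ⟨k, hk, rfl⟩ := exists_nodeAt σ v
  rw [cycleMap_nodeAt hk, nextPos]
  intro h
  split_ifs at h
  · have := (nodeAt_inj (by omega) hk).1 h; omega
  · have := (nodeAt_inj (by omega) hk).1 h; omega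
  · have := (nodeAt_inj (by omega) hk).1 h; omega

omit [NeZero n] in
lemma IsConfig.add_two_le (h : IsConfig n m s w) : w + 2 ≤ n := by
  obtain ⟨h1, h2, h3, h4⟩ := h; omega

lemma IsConfig.cycleMap_ne (h : IsConfig n m s w) (v : Fin n) : cycleMap σ m w v ≠ v :=
  _root_.cycleMap_ne h.two_le h.add_two_le v

lemma IsConfig.nooseMap_ne (h : IsConfig n m s w) (v : Fin n) : nooseMap σ m s w v ≠ v := by
  unfold nooseMap
  obtain ⟨h1, h2, h3, h4⟩ := id h
  split_ifs with hv
  · rw [hv]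
    intro h'
    have := (nodeAt_inj h2 (by omega)).1 h'
    omega
  · exact h.cycleMap_ne v

lemma cycleMap_eq_nooseMap (v : Fin n) (hv : v ≠ nodeAt σ s) :
    cycleMap σ m w v = nooseMap σ m s w v := by
  simp [nooseMap, hv]

lemma IsConfig.cycleMap_ne_nooseMap (h : IsConfig n m s w) :
    cycleMap σ m w (nodeAt σ s) ≠ nooseMap σ m s w (nodeAt σ s) := by
  obtain ⟨h1, h2, h3, h4⟩ := h
  rw [nooseMap_nodeAt (by omega) (by omega), cycleMap_nodeAt (by omega), if_pos rfl, nextPos]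
  intro h'
  split_ifs at h'
  · have := (nodeAt_inj (by omega) (by omega)).1 h'; omega
  · omega
  · have := (nodeAt_inj (by omega) (by omega)).1 h'; omega

lemma iterate_cycleMap (hm : m ≤ n) {k : ℕ} (hk : k < m) :
    (cycleMap σ m w)^[k] (nodeAt σ 0) = nodeAt σ k := by
  have := iterate_nodeAt (σ := σ) (F := cycleMap σ m w) (a := 0) (K := m - 1) (fun k _ hk => by
    rw [cycleMap_nodeAt (by omega), nextPos, if_neg (by omega), if_neg (by omega)])
    (k := k) (by omega)
  simpa using this

lemma iterate_cycleMap_period (hm0 : 0 < m) (hm : m ≤ n) :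
    (cycleMap σ m w)^[m] (nodeAt σ 0) = nodeAt σ 0 := by
  obtain ⟨k, rfl⟩ := Nat.exists_eq_succ_of_ne_zero hm0.ne'
  rw [Function.iterate_succ_apply', iterate_cycleMap hm (by omega), cycleMap_nodeAt (by omega),
    nextPos, if_pos rfl]

lemma iterate_cycleMap_tail (hms : m ≤ n) {k : ℕ} (hk : m + k < n) :
    (cycleMap σ m w)^[k] (nodeAt σ m) = nodeAt σ (m + k) :=
  iterate_nodeAt (K := n - 1 - m) (fun k _ hk => by
    rw [cycleMap_nodeAt (by omega), nextPos, if_neg (by omega), if_neg (by omega)]) (by omega)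

lemma IsConfig.iterate_nooseMap (h : IsConfig n m s w) {k : ℕ} (hk : k ≤ s) :
    (nooseMap σ m s w)^[k] (nodeAt σ 0) = nodeAt σ k := by
  obtain ⟨h1, h2, h3, h4⟩ := h
  have := iterate_nodeAt (σ := σ) (F := nooseMap σ m s w) (a := 0) (K := s) (fun k _ hk => by
    rw [nooseMap_nodeAt (by omega) (by omega), nextPos, if_neg (by omega), if_neg (by omega),
      if_neg (by omega)]) (k := k) (by omega)
  simpa using this

lemma IsConfig.iterate_nooseMap_tail (h : IsConfig n m s w) {k : ℕ} (hk : m + k < n) :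
    (nooseMap σ m s w)^[k + (s + 1)] (nodeAt σ 0) = nodeAt σ (m + k) := by
  obtain ⟨h1, h2, h3, h4⟩ := id h
  rw [Function.iterate_add_apply, Function.iterate_succ_apply', h.iterate_nooseMap le_rfl,
    nooseMap_nodeAt (by omega) (by omega), if_pos rfl]
  exact iterate_nodeAt (K := n - 1 - m) (fun k _ hk => by
    rw [nooseMap_nodeAt (by omega) (by omega), nextPos, if_neg (by omega), if_neg (by omega),
      if_neg (by omega)]) (by omega)

lemma IsConfig.iterate_nooseMap_ne (h : IsConfig n m s w) (t : ℕ) :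
    (nooseMap σ m s w)^[t + 1] (nodeAt σ 0) ≠ nodeAt σ 0 := by
  obtain ⟨h1, h2, h3, h4⟩ := id h
  -- The invariant: after its first step the walk stays in the positions `1, …, s` and `m, …, n -
  -- 1`.
  have key : ∃ k, k < n ∧ (1 ≤ k ∧ k ≤ s ∨ m ≤ k) ∧
      (nooseMap σ m s w)^[t + 1] (nodeAt σ 0) = nodeAt σ k := by
    induction t with
    | zero =>
      refine ⟨if 0 = s then m else nextPos n m w 0, ?_, ?_, ?_⟩
      · unfold nextPos; split_ifs <;> omega
      · unfold nextPos; split_ifs <;> omega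
      · rw [zero_add, Function.iterate_one, nooseMap_nodeAt (by omega) (by omega)]
    | succ t ih =>
      obtain ⟨k, hk1, hk2, hk3⟩ := ih
      refine ⟨if k = s then m else nextPos n m w k, ?_, ?_, ?_⟩
      · unfold nextPos; split_ifs <;> omega
      · unfold nextPos; split_ifs <;> omega
      · rw [Function.iterate_succ_apply', hk3, nooseMap_nodeAt (by omega) (by omega)]
  obtain ⟨k, hk1, hk2, hk3⟩ := key
  rw [hk3]
  intro h'
  have := (nodeAt_inj hk1 (by omega)).1 h'
  omega

variable {β : ℝ}

lemma occupation_cycleMap (h0 : 0 < β) (h1 : β < 1) (hσ : σ 0 = 0) (hm : 0 < m) (hmn : m ≤ n) :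
    occupation β 0 (cycleMap σ m w) 0 = 1 / (1 - β ^ m) := by
  have hz := nodeAt_zero hσ
  refine occupation_root_of_period h0 h1 hm ?_ fun t ht htm => ?_
  · have := iterate_cycleMap_period (σ := σ) (w := w) hm hmn
    rwa [hz] at this
  · have := iterate_cycleMap (σ := σ) (w := w) hmn htm
    rw [hz] at this
    rw [this, ← hz]
    intro h'
    have := (nodeAt_inj (by omega) (by omega)).1 h'
    omega

lemma IsConfig.occupation_nooseMap (h : IsConfig n m s w) (hσ : σ 0 = 0) :
    occupation β 0 (nooseMap σ m s w) 0 = 1 := by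
  refine occupation_root_of_ne fun t => ?_
  have := h.iterate_nooseMap_ne (σ := σ) t
  rwa [nodeAt_zero hσ] at this

lemma IsConfig.card_configGraph (h : IsConfig n m s w) :
    (configGraph σ m s w).card = n + 1 := by
  have := card_pairGraph (f := cycleMap σ m w) (f' := nooseMap σ m s w) (s := nodeAt σ s)
    h.cycleMap_ne h.nooseMap_ne cycleMap_eq_nooseMap h.cycleMap_ne_nooseMap
  simpa [configGraph] using this

/-- The `cycleMap` walk visits the positions below `m`, the `nooseMap` walk those up to `s` and from
`m` on. The splitting node is visited by both, so the combined flow is positive on all arcs.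
Independence holds since the root outflows `1 / (1 - β ^ m)` and `1` differ. -/
lemma IsConfig.exists_isFeasibleBasisFor (h : IsConfig n m s w) (h0 : 0 < β) (h1 : β < 1)
    (hσ : σ 0 = 0) : ∃ x, IsFeasibleBasisFor β 0 Set.univ (configGraph σ m s w) x ∧
      supportArcs x = configGraph σ m s w := by
  obtain ⟨hc1, hc2, hc3, hc4⟩ := id h
  have hocc := occupation_cycleMap (w := w) h0 h1 hσ (show 0 < m by omega) hc2.le
  have hocc' := h.occupation_nooseMap (β := β) hσ
  obtain ⟨x, hx, hsupp⟩ := exists_mem_hPolytope_supportArcs (r := 0) h0 h1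
    h.cycleMap_ne h.nooseMap_ne (show 0 < m by omega) (by simpa using hc2) hocc hocc'
  have hz := nodeAt_zero hσ
  have hsupp' : supportArcs x = configGraph σ m s w := by
    rw [hsupp]
    ext e
    simp only [Set.mem_ofPred_eq, configGraph, Finset.mem_coe, mem_pairGraph]
    constructor
    · rintro (h | h)
      · exact Or.inl h.1
      · exact Or.inr h.1
    · obtain ⟨k, hk, hke⟩ := exists_nodeAt σ e.tail
      intro he
      rw [← hke] at he ⊢
      have hA : k < m → ∃ t, (cycleMap σ m w)^[t] 0 = nodeAt σ k :=
        fun hkm => ⟨k, by rw [← hz]; exact iterate_cycleMap hc2.le hkm⟩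
      have hB : k ≤ s ∨ m ≤ k → ∃ t, (nooseMap σ m s w)^[t] 0 = nodeAt σ k := by
        rintro (hks | hmk)
        · exact ⟨k, by rw [← hz]; exact h.iterate_nooseMap hks⟩
        · obtain ⟨j, rfl⟩ := Nat.exists_eq_add_of_le hmk
          exact ⟨j + (s + 1), by rw [← hz]; exact h.iterate_nooseMap_tail hk⟩
      by_cases hks : k = s
      · rcases he with he | he
        · exact Or.inl ⟨he, hA (by omega)⟩
        · exact Or.inr ⟨he, hB (by omega)⟩
      · have heq := cycleMap_eq_nooseMap (σ := σ) (m := m) (s := s) (w := w) (nodeAt σ k)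
          fun h' => hks ((nodeAt_inj hk (by omega)).1 h')
        rw [heq, or_self] at he
        by_cases hkm : k < m
        · exact Or.inl ⟨by rw [heq, he], hA hkm⟩
        · exact Or.inr ⟨he, hB (by omega)⟩
  refine ⟨x, ⟨Set.subset_univ _, ?_, ?_, hx, ?_⟩, hsupp'⟩
  · rw [h.card_configGraph, Fintype.card_fin]
  · refine linearIndepOn_pairGraph (s := nodeAt σ s) h0 h1 h.cycleMap_ne h.nooseMap_ne
      cycleMap_eq_nooseMap ?_
    rw [hocc, hocc']
    have hbm : 0 < β ^ m := by positivity
    have hbm1 : β ^ m < 1 := pow_lt_one₀ h0.le h1 (by omega)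
    rw [Ne, div_eq_one_iff_eq (by linarith)]
    intro h'
    linarith
  · exact eq_zero_of_supportArcs_subset hx hsupp'.subset

/-- The splitting node is the only node with two out-arcs, so it is determined. The only ambiguity
left is which of its two arcs belongs to which map; a swap would give `f = g'`, but `f` returns to
the root and `g'` never does. -/
lemma pairGraph_inj {V : Type*} [Fintype V] [DecidableEq V] {r s t : V} {f f' g g' : V → V}
    {m : ℕ} (hf : ∀ v, f v ≠ v) (hf' : ∀ v, f' v ≠ v) (hg : ∀ v, g v ≠ v) (hg' : ∀ v, g' v ≠ v)
    (hs : ∀ v, v ≠ s → f v = f' v) (hss : f s ≠ f' s) (ht : ∀ v, v ≠ t → g v = g' v)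
    (hm : f^[m + 1] r = r) (hr : ∀ k, g'^[k + 1] r ≠ r)
    (h : pairGraph f f' = pairGraph g g') : f = g ∧ f' = g' ∧ s = t := by
  have key : ∀ v u, u ≠ v → ((u = f v ∨ u = f' v) ↔ (u = g v ∨ u = g' v)) := by
    intro v u huv
    have := Finset.ext_iff.1 h ⟨(v, u), huv.symm⟩
    simpa [Arc.head, Arc.tail] using this
  have k1 := fun v => (key v (f v) (hf v)).1 (Or.inl rfl)
  have k2 := fun v => (key v (f' v) (hf' v)).1 (Or.inr rfl)
  have k3 := fun v => (key v (g v) (hg v)).2 (Or.inl rfl)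
  have k4 := fun v => (key v (g' v) (hg' v)).2 (Or.inr rfl)
  have hst : s = t := by
    by_contra hst
    have h1 := k1 s
    have h2 := k2 s
    rw [ht s hst] at h1 h2
    simp only [or_self] at h1 h2
    exact hss (h1.trans h2.symm)
  subst hst
  have hoff : ∀ v, v ≠ s → f v = g v := by
    intro v hv
    have := k3 v
    rw [hs v hv] at *
    simp only [or_self] at this
    exact this.symm
  have hfg : f s = g s := by
    rcases k1 s with h1 | h1
    · exact h1
    · exfalso
      have : f = g' := by
        ext v
        by_cases hv : v = s
        · rw [hv, h1]
        · rw [hoff v hv, ht v hv]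
      exact hr m (this ▸ hm)
  refine ⟨?_, ?_, rfl⟩
  · ext v
    by_cases hv : v = s
    · rw [hv, hfg]
    · exact hoff v hv
  · ext v
    by_cases hv : v = s
    · rw [hv]
      rcases k2 s with h1 | h1
      · exact absurd (hfg.trans h1.symm) hss
      · exact h1
    · rw [← hs v hv, ← ht v hv, hoff v hv]

/-- One half of the equality of lengths; the other follows by symmetry. If `m < m'`, then the node
at position `m` of `τ` would be the root. -/
lemma length_eq_of_cycleMap_eq {m' w' : ℕ} (hσ : σ 0 = 0) (hτ : τ 0 = 0) (hm : 0 < m)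
    (hmn : m ≤ n) (hmn' : m' ≤ n) (h : cycleMap σ m w = cycleMap τ m' w') : m' ≤ m := by
  by_contra! hlt
  have h1 := iterate_cycleMap_period (σ := σ) (w := w) hm hmn
  have h2 := iterate_cycleMap (σ := τ) (w := w') hmn' hlt
  rw [h, nodeAt_zero hσ, ← nodeAt_zero hτ, h2] at h1
  have := (nodeAt_inj (by omega) (by omega)).1 h1
  omega

/-- The arcs determine both maps, and the maps determine the code: `m` is the return time of the
root, the orbit of the root under `cycleMap` gives the first `m` nodes, `nooseMap` sends the
splitting node to position `m`, the orbit from there gives the remaining nodes, and the image of the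
last one gives `w`. -/
lemma configGraph_inj {m' s' w' : ℕ} (hσ : σ 0 = 0) (hτ : τ 0 = 0) (h : IsConfig n m s w)
    (h' : IsConfig n m' s' w') (heq : configGraph σ m s w = configGraph τ m' s' w') :
    σ = τ ∧ m = m' ∧ s = s' ∧ w = w' := by
  obtain ⟨h1, h2, h3, h4⟩ := id h
  obtain ⟨h1', h2', h3', h4'⟩ := id h'
  have hz := nodeAt_zero hσ
  have hz' := nodeAt_zero hτ
  obtain ⟨hA, hB, hs⟩ := pairGraph_inj (r := 0) (m := m - 1) h.cycleMap_ne h.nooseMap_ne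
    h'.cycleMap_ne h'.nooseMap_ne cycleMap_eq_nooseMap h.cycleMap_ne_nooseMap
    cycleMap_eq_nooseMap
    (by rw [← hz, show m - 1 + 1 = m by omega]; exact iterate_cycleMap_period (by omega) h2.le)
    (by rw [← hz']; exact h'.iterate_nooseMap_ne) heq
  have hm : m = m' := le_antisymm
    (length_eq_of_cycleMap_eq hτ hσ (by omega) h2'.le h2.le hA.symm)
    (length_eq_of_cycleMap_eq hσ hτ (by omega) h2.le h2'.le hA)
  subst hm
  have hcyc : ∀ k < m, nodeAt σ k = nodeAt τ k := by
    intro k hk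
    rw [← iterate_cycleMap (w := w) h2.le hk, ← iterate_cycleMap (σ := τ) (w := w') h2.le hk, hA,
      hz, hz']
  rw [hcyc s h3] at hs
  have hs' := (nodeAt_inj (by omega) (by omega)).1 hs
  subst hs'
  have hm : nodeAt σ m = nodeAt τ m := by
    have := congrFun hB (nodeAt τ s)
    rw [nooseMap_nodeAt (by omega) (by omega), if_pos rfl, ← hcyc s h3,
      nooseMap_nodeAt (by omega) (by omega), if_pos rfl] at this
    exact this
  have hall : ∀ k < n, nodeAt σ k = nodeAt τ k := by
    intro k hk
    by_cases hkm : k < m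
    · exact hcyc k hkm
    · obtain ⟨j, rfl⟩ := Nat.exists_eq_add_of_le (not_lt.1 hkm)
      rw [← iterate_cycleMap_tail (w := w) h2.le hk,
        ← iterate_cycleMap_tail (σ := τ) (w := w') h2.le hk, hA, hm]
  have hστ := perm_ext_nodeAt hall
  subst hστ
  refine ⟨rfl, rfl, rfl, ?_⟩
  have := congrFun hA (nodeAt σ (n - 1))
  rw [cycleMap_nodeAt (by omega), cycleMap_nodeAt (by omega), nextPos, nextPos,
    if_neg (by omega), if_pos (by omega), if_neg (by omega), if_pos (by omega)] at this
  exact (nodeAt_inj (by omega) (by omega)).1 this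

end Configuration

/-! ### Arcs of closed walks given by lists -/

section Walks

variable {V : Type*}

/-- The final node `x` also serves as the default value of `getD`: index `l.length` reads as `x`, so
the closing arc needs no separate case. -/
lemma mem_walkArcs_concat {l : List V} {x : V} {e : Arc V} :
    e ∈ walkArcs (l ++ [x]) ↔
      ∃ k < l.length, e.tail = l.getD k x ∧ e.head = l.getD (k + 1) x := by
  have key : ∀ k ≤ l.length, (l ++ [x])[k]? = some (l.getD k x) := by
    intro k hk
    rcases hk.lt_or_eq with hk | rfl
    · rw [List.getElem?_append_left hk, List.getD_eq_getElem?_getD]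
      simp [hk]
    · simp
  have h1 : e ∈ walkArcs (l ++ [x]) ↔
      ∃ k, (l ++ [x])[k]? = some e.tail ∧ (l ++ [x])[k + 1]? = some e.head := by
    constructor
    · rintro ⟨a, b, hab⟩
      refine ⟨a.length, ?_⟩
      rw [← hab]
      simp
    · rintro ⟨k, hk1, hk2⟩
      refine ⟨(l ++ [x]).take k, (l ++ [x]).drop (k + 2), ?_⟩
      obtain ⟨hk1', hk1⟩ := List.getElem?_eq_some_iff.1 hk1
      obtain ⟨hk2', hk2⟩ := List.getElem?_eq_some_iff.1 hk2
      conv_rhs => rw [← List.take_append_drop k (l ++ [x]), List.drop_eq_getElem_cons hk1',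
        List.drop_eq_getElem_cons hk2', hk1, hk2]
      simp
  rw [h1]
  constructor
  · rintro ⟨k, hk1, hk2⟩
    have hk : k < l.length := by
      have := (List.getElem?_eq_some_iff.1 hk2).1
      simpa using this
    refine ⟨k, hk, ?_, ?_⟩
    · rw [key k hk.le] at hk1
      exact (Option.some.inj hk1).symm
    · rw [key (k + 1) hk] at hk2
      exact (Option.some.inj hk2).symm
  · rintro ⟨k, hk, h1, h2⟩
    exact ⟨k, by rw [key k hk.le, h1], by rw [key (k + 1) hk, h2]⟩

lemma getD_inj {l : List V} (hl : l.Nodup) {x : V} {i j : ℕ} (hi : i < l.length)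
    (hj : j < l.length) (h : l.getD i x = l.getD j x) : i = j := by
  rw [List.getD_eq_getElem _ _ hi, List.getD_eq_getElem _ _ hj] at h
  exact (hl.getElem_inj_iff).1 h

lemma mem_iff_getD {l : List V} (x : V) {v : V} :
    v ∈ l ↔ ∃ k < l.length, v = l.getD k x := by
  rw [List.mem_iff_getElem]
  constructor
  · rintro ⟨k, hk, rfl⟩
    exact ⟨k, hk, (List.getD_eq_getElem _ _ hk).symm⟩
  · rintro ⟨k, hk, rfl⟩
    exact ⟨k, hk, (List.getD_eq_getElem _ _ hk).symm⟩

lemma getD_map_range (g : ℕ → V) (K k : ℕ) (x : V) :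
    ((List.range K).map g).getD k x = if k < K then g k else x := by
  split_ifs with h
  · rw [List.getD_eq_getElem _ _ (by simpa using h)]
    simp
  · rw [List.getD_eq_default _ _ (by simpa using h)]

lemma cons_map_range' (g : ℕ → V) {K : ℕ} (hK : 0 < K) :
    g 0 :: (List.range' 1 (K - 1)).map g = (List.range K).map g := by
  obtain ⟨K, rfl⟩ := Nat.exists_eq_succ_of_ne_zero hK.ne'
  rw [List.range_eq_range', List.range'_succ]
  simp

lemma nodup_map_range {g : ℕ → V} {K : ℕ} (hg : ∀ i < K, ∀ j < K, g i = g j → i = j) :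
    ((List.range K).map g).Nodup := by
  refine List.Nodup.map_on (fun i hi j hj h => ?_) List.nodup_range
  exact hg i (List.mem_range.1 hi) j (List.mem_range.1 hj) h

end Walks

/-! ### Hamiltonian cycles as orderings of the nodes -/

section HamiltonianCycle

variable {n : ℕ} [NeZero n]

lemma exists_perm_of_injOn (g : ℕ → Fin n) (hg : ∀ i < n, ∀ j < n, g i = g j → i = j) :
    ∃ σ : Equiv.Perm (Fin n), ∀ k < n, nodeAt σ k = g k := by
  have hinj : Function.Injective (fun k : Fin n => g k) := fun i j h =>
    Fin.ext (hg i i.2 j j.2 h)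
  refine ⟨Equiv.ofBijective _ (Finite.injective_iff_bijective.1 hinj), fun k hk => ?_⟩
  simp [nodeAt, Nat.mod_eq_of_lt hk]

/-- With `m = n` the successor of positions is the full cyclic shift. The branch with `w` is never
reached, so the value `0` is a placeholder. -/
lemma mem_cycle_iff {σ : Equiv.Perm (Fin n)} {e : Arc (Fin n)} :
    e.head = cycleMap σ n 0 e.tail ↔
      ∃ k < n, e.tail = nodeAt σ k ∧ e.head = nodeAt σ (if k + 1 < n then k + 1 else 0) := by
  constructor
  · intro h
    obtain ⟨k, hk, hke⟩ := exists_nodeAt σ e.tail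
    refine ⟨k, hk, hke.symm, ?_⟩
    rw [h, ← hke, cycleMap_nodeAt hk, nextPos]
    congr 1
    split_ifs <;> omega
  · rintro ⟨k, hk, h1, h2⟩
    rw [h1, h2, cycleMap_nodeAt hk, nextPos]
    congr 1
    split_ifs <;> omega

lemma isHamiltonianCycle_iff (hn : 2 ≤ n) {S : Set (Arc (Fin n))} :
    IsHamiltonianCycle 0 S ↔
      ∃ σ : Equiv.Perm (Fin n), σ 0 = 0 ∧ S = {e | e.head = cycleMap σ n 0 e.tail} := by
  constructor
  · rintro ⟨vs, hvs, hnd, hall, rfl⟩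
    have hlen : (0 :: vs).length = n := by
      have h1 : (0 :: vs).toFinset = Finset.univ := by
        ext v; simpa using hall v
      have h2 := List.toFinset_card_of_nodup hnd
      rw [h1, Finset.card_univ, Fintype.card_fin] at h2
      exact h2.symm
    obtain ⟨σ, hσ⟩ := exists_perm_of_injOn (fun k => (0 :: vs).getD k 0)
      fun i hi j hj h => getD_inj hnd (hi.trans_eq hlen.symm) (hj.trans_eq hlen.symm) h
    have hz : nodeAt σ 0 = 0 := by rw [hσ 0 (by omega)]; rfl
    refine ⟨σ, by simpa [nodeAt] using hz, ?_⟩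
    ext e
    rw [mem_walkArcs_concat, Set.mem_ofPred_eq, mem_cycle_iff, hlen]
    refine exists_congr fun k => and_congr_right fun hk => ?_
    rw [hσ k hk]
    split_ifs with h
    · rw [hσ _ h]
    · have h0 : (0 :: vs).getD (k + 1) 0 = 0 := List.getD_eq_default _ _ (by omega)
      rw [hz, h0]
  · rintro ⟨σ, hσ, rfl⟩
    have hz := nodeAt_zero hσ
    have hlist : (0 : Fin n) :: (List.range' 1 (n - 1)).map (nodeAt σ) =
        (List.range n).map (nodeAt σ) := by
      rw [← cons_map_range' _ (show 0 < n by omega), hz]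
    refine ⟨(List.range' 1 (n - 1)).map (nodeAt σ), ?_, ?_, ?_, ?_⟩
    · rw [Ne, ← List.length_eq_zero_iff]
      simp only [List.length_map, List.length_range']
      omega
    · rw [hlist]
      exact nodup_map_range fun i hi j hj => (nodeAt_inj hi hj).1
    · intro v
      rw [hlist]
      obtain ⟨k, hk, rfl⟩ := exists_nodeAt σ v
      exact List.mem_map.2 ⟨k, List.mem_range.2 hk, rfl⟩
    · ext e
      rw [hlist, mem_walkArcs_concat, Set.mem_ofPred_eq, mem_cycle_iff]
      simp only [List.length_map, List.length_range, getD_map_range]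
      refine exists_congr fun k => and_congr_right fun hk => ?_
      rw [if_pos hk]
      split_ifs with h
      · rfl
      · rw [hz]

end HamiltonianCycle

/-! ### From unions of walks to configurations -/

section Lists

variable {n : ℕ} [NeZero n] {σ : Equiv.Perm (Fin n)} {m s w : ℕ}

/-- The position of the `k`-th node of the noose path, which branches off at position `s`. -/
def noosePos (m s k : ℕ) : ℕ := if k ≤ s then k else k - (s + 1) + m

/-- Away from position `s` both maps agree, so an arc can be assigned to whichever walk visits its
tail. The noose path has `s + 1` nodes up to the split and `n - m` after it, whence `hℓ`. -/
lemma IsConfig.mem_configGraph_iff (h : IsConfig n m s w) {C N : ℕ → Fin n} {ℓ : ℕ}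
    (hℓ : m + ℓ = n + s + 1) (hC : ∀ k < m, C k = nodeAt σ k) (hCm : C m = nodeAt σ 0)
    (hN : ∀ k < ℓ, N k = nodeAt σ (noosePos m s k)) (hNℓ : N ℓ = nodeAt σ w) {e : Arc (Fin n)} :
    e ∈ configGraph σ m s w ↔ (∃ k < m, e.tail = C k ∧ e.head = C (k + 1)) ∨
      ∃ k < ℓ, e.tail = N k ∧ e.head = N (k + 1) := by
  obtain ⟨h1, h2, h3, h4⟩ := id h
  have hCs : ∀ k < m, C (k + 1) = cycleMap σ m w (nodeAt σ k) := by
    intro k hk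
    rw [cycleMap_nodeAt (by omega), nextPos]
    split_ifs with h5 h6
    · rw [h5, hCm]
    · omega
    · rw [hC _ (by omega)]
  have hNs : ∀ k < ℓ, N (k + 1) = nooseMap σ m s w (nodeAt σ (noosePos m s k)) := by
    intro k hk
    rw [nooseMap_nodeAt (by unfold noosePos; split_ifs <;> omega) (by omega), nextPos]
    by_cases hkl : k + 1 = ℓ
    · rw [hkl, hNℓ]
      congr 1
      unfold noosePos
      split_ifs <;> omega
    · rw [hN _ (by omega)]
      congr 1
      unfold noosePos
      split_ifs <;> omega
  rw [configGraph, mem_pairGraph]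
  constructor
  · obtain ⟨k, hk, hke⟩ := exists_nodeAt σ e.tail
    have hA : k < m → e.head = cycleMap σ m w e.tail →
        ∃ k < m, e.tail = C k ∧ e.head = C (k + 1) := fun hkm he =>
      ⟨k, hkm, by rw [hC k hkm, hke], by rw [hCs k hkm, hke, he]⟩
    have hB : k ≤ s ∨ m ≤ k → e.head = nooseMap σ m s w e.tail →
        ∃ k < ℓ, e.tail = N k ∧ e.head = N (k + 1) := by
      intro hk' he
      obtain ⟨j, hj, rfl⟩ : ∃ j < ℓ, noosePos m s j = k := by
        rcases hk' with hk' | hk'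
        · exact ⟨k, by omega, by unfold noosePos; split_ifs; omega⟩
        · exact ⟨k - m + (s + 1), by omega, by unfold noosePos; split_ifs <;> omega⟩
      exact ⟨j, hj, by rw [hN j hj, hke], by rw [hNs j hj, hke, he]⟩
    intro he
    by_cases hks : k = s
    · rcases he with he | he
      · exact Or.inl (hA (by omega) he)
      · exact Or.inr (hB (by omega) he)
    · have heq := cycleMap_eq_nooseMap (σ := σ) (m := m) (s := s) (w := w) e.tail
        fun h' => hks ((nodeAt_inj hk (by omega)).1 (hke.trans h'))
      by_cases hkm : k < m
      · exact Or.inl (hA hkm (by rwa [← heq, or_self] at he))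
      · exact Or.inr (hB (by omega) (by rwa [heq, or_self] at he))
  · rintro (⟨k, hk, he1, he2⟩ | ⟨k, hk, he1, he2⟩)
    · left; rw [he2, he1, hCs k hk, hC k hk]
    · right; rw [he2, he1, hNs k hk, hN k hk]

/-- A spanning union of a short cycle and a noose path with at most `n + 1` arcs branches only
once. -/
lemma exists_config {S : Set (Arc (Fin n))} {C N : ℕ → Fin n} {ℓ j : ℕ}
    (hS : ∀ e, e ∈ S ↔ (∃ k < m, e.tail = C k ∧ e.head = C (k + 1)) ∨
      ∃ k < ℓ, e.tail = N k ∧ e.head = N (k + 1))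
    (hcard : S.ncard ≤ n + 1) (hall : ∀ v, (∃ k < m, v = C k) ∨ ∃ k < ℓ, v = N k)
    (hm : 2 ≤ m) (hmn : m < n) (hC : ∀ i < m, ∀ k < m, C i = C k → i = k)
    (hN : ∀ i < ℓ, ∀ k < ℓ, N i = N k → i = k) (hC0 : C 0 = 0) (hCm : C m = 0) (hN0 : N 0 = 0)
    (hj : 1 ≤ j) (hjl : j + 2 ≤ ℓ) (hNℓ : N ℓ = N j) (hloop : ∀ k < ℓ, N (k + 1) ≠ N k)
    (hloopC : ∀ k < m, C (k + 1) ≠ C k) :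
    ∃ σ s w, σ 0 = 0 ∧ IsConfig n m s w ∧ S = configGraph σ m s w ∧ m + ℓ = n + s + 1 ∧
      (∀ k < m, C k = nodeAt σ k) ∧ (∀ k < ℓ, N k = nodeAt σ (noosePos m s k)) ∧
      w = noosePos m s j := by
  classical
  -- Since `m < n`, some node is missed by the cycle and must lie on the noose path.
  have hex : ∃ k, k < ℓ ∧ ∀ i < m, N k ≠ C i := by
    by_contra! hcon
    have : Finset.univ ⊆ (Finset.range m).image C := by
      intro v _
      rw [Finset.mem_image]
      rcases hall v with ⟨k, hk, rfl⟩ | ⟨k, hk, rfl⟩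
      · exact ⟨k, Finset.mem_range.2 hk, rfl⟩
      · obtain ⟨i, hi, h⟩ := hcon k hk
        exact ⟨i, Finset.mem_range.2 hi, h.symm⟩
    have h1 := (Finset.card_le_card this).trans Finset.card_image_le
    simp at h1
    omega
  -- `N K` is the first node of the noose path off the cycle; its predecessor `N s` is the splitting
  -- node.
  obtain ⟨K, ⟨hKl, hKC⟩, hKmin⟩ : ∃ K, (K < ℓ ∧ ∀ i < m, N K ≠ C i) ∧
      ∀ k < K, ∃ i < m, N k = C i := by
    refine ⟨Nat.find hex, Nat.find_spec hex, fun k hk => ?_⟩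
    have := Nat.find_min hex hk
    push Not at this
    exact this (hk.trans (Nat.find_spec hex).1)
  obtain ⟨s, rfl⟩ : ∃ s, K = s + 1 := by
    refine Nat.exists_eq_succ_of_ne_zero ?_
    rintro rfl
    exact hKC 0 (by omega) (by rw [hN0, hC0])
  have hCarc : ∀ k, (hk : k < m) →
      (⟨(C k, C (k + 1)), (hloopC k hk).symm⟩ : Arc (Fin n)) ∈ S := fun k hk =>
    (hS _).2 (Or.inl ⟨k, hk, rfl, rfl⟩)
  have hNarc : ∀ k, (hk : k < ℓ) →
      (⟨(N k, N (k + 1)), (hloop k hk).symm⟩ : Arc (Fin n)) ∈ S := fun k hk =>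
    (hS _).2 (Or.inr ⟨k, hk, rfl, rfl⟩)
  have hout : ∀ v, ∃ e ∈ S, e.tail = v := by
    intro v
    rcases hall v with ⟨k, hk, rfl⟩ | ⟨k, hk, rfl⟩
    · exact ⟨_, hCarc k hk, rfl⟩
    · exact ⟨_, hNarc k hk, rfl⟩
  choose out hout1 hout2 using hout
  obtain ⟨e1, he1, he1t, he1o⟩ : ∃ e1 ∈ S, e1.tail = N s ∧ e1 ≠ out (N s) := by
    obtain ⟨i, hi, hsi⟩ := hKmin s (by omega)
    by_cases h : out (N s) = ⟨(N s, N (s + 1)), (hloop s (by omega)).symm⟩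
    · refine ⟨_, hCarc i hi, hsi.symm, fun h' => ?_⟩
      rw [h] at h'
      have h2 : C (i + 1) = N (s + 1) := congrArg Arc.head h'
      by_cases him : i + 1 = m
      · rw [him, hCm, ← hC0] at h2
        exact hKC 0 (by omega) h2.symm
      · exact hKC (i + 1) (by omega) h2.symm
    · exact ⟨_, hNarc s (by omega), rfl, fun h' => h h'.symm⟩
  -- One out-arc per node and the second out-arc `e1` of `N s` already make `n + 1` arcs; another
  -- branching would exceed the bound.
  have huniq : ∀ e ∈ S, e.tail ≠ N s → e = out e.tail := by
    intro e he het
    by_contra hne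
    have h1 : ((insert e (insert e1 (Finset.univ.image out)) : Finset (Arc (Fin n))) :
        Set (Arc (Fin n))) ⊆ S := by
      intro a ha
      simp only [Finset.coe_insert, Finset.coe_image, Finset.coe_univ, Set.image_univ,
        Set.mem_insert_iff, Set.mem_range] at ha
      rcases ha with rfl | rfl | ⟨v, rfl⟩
      · exact he
      · exact he1
      · exact hout1 v
    have h2 := Set.ncard_le_ncard h1 (Set.toFinite _)
    rw [Set.ncard_coe_finset, Finset.card_insert_of_notMem, Finset.card_insert_of_notMem,
      Finset.card_image_of_injective, Finset.card_univ, Fintype.card_fin] at h2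
    · omega
    · intro u v huv
      rw [← hout2 u, huv, hout2]
    · simp only [Finset.mem_image, Finset.mem_univ, true_and, not_exists]
      rintro v rfl
      rw [hout2] at he1t
      exact he1o (by rw [he1t])
    · simp only [Finset.mem_insert, Finset.mem_image, Finset.mem_univ, true_and, not_or,
        not_exists]
      refine ⟨?_, ?_⟩
      · rintro rfl
        exact het he1t
      · rintro v rfl
        rw [hout2] at hne
        exact hne rfl
  have hstep : ∀ i < m, ∀ k < ℓ, C i = N k → k ≠ s → C (i + 1) = N (k + 1) := by
    intro i hi k hk hik hks
    have hks' : N k ≠ N s := fun h => hks (hN k hk s (by omega) h)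
    have h1 := huniq _ (hCarc i hi) (by change C i ≠ N s; rwa [hik])
    have h2 := huniq _ (hNarc k hk) hks'
    have h3 : out (C i) = out (N k) := by rw [hik]
    have h4 := (h1.trans h3).trans h2.symm
    exact congrArg Arc.head h4
  have hprefix : ∀ k ≤ s, k < m ∧ C k = N k := by
    intro k hk
    induction k with
    | zero => exact ⟨by omega, by rw [hC0, hN0]⟩
    | succ k ih =>
      obtain ⟨hkm, hkeq⟩ := ih (by omega)
      have h1 := hstep k hkm k (by omega) hkeq (by omega)
      refine ⟨?_, h1⟩
      by_contra hcon
      have : k + 1 = m := by omega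
      rw [this, hCm, ← hN0, ← this] at h1
      have := hN 0 (by omega) (k + 1) (by omega) h1
      omega
  have hsm := (hprefix s le_rfl).1
  -- Beyond the split the cycle cannot meet the noose path again: it would have to follow it from
  -- there on, and the noose path never comes back to the root. The induction runs backwards from
  -- the end of the cycle.
  have hsuffix : ∀ d i, i + d + 1 = m → s < i → ∀ k < ℓ, C i ≠ N k := by
    intro d
    induction d with
    | zero =>
      intro i hi hsi k hk hik
      have hks : k ≠ s := by
        rintro rfl
        have := hC i (by omega) k (by omega) (by rw [hik, (hprefix k le_rfl).2])
        omega
      have h1 := hstep i (by omega) k hk hik hks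
      rw [show i + 1 = m by omega, hCm, ← hN0] at h1
      by_cases hkl : k + 1 = ℓ
      · rw [hkl, hNℓ] at h1
        have := hN 0 (by omega) j (by omega) h1
        omega
      · have := hN 0 (by omega) (k + 1) (by omega) h1
        omega
    | succ d ih =>
      intro i hi hsi k hk hik
      have hks : k ≠ s := by
        rintro rfl
        have := hC i (by omega) k (by omega) (by rw [hik, (hprefix k le_rfl).2])
        omega
      have h1 := hstep i (by omega) k hk hik hks
      by_cases hkl : k + 1 = ℓ
      · rw [hkl, hNℓ] at h1
        exact ih (i + 1) (by omega) (by omega) j (by omega) h1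
      · exact ih (i + 1) (by omega) (by omega) (k + 1) (by omega) h1
  have hdisj : ∀ k, s < k → k < ℓ → ∀ i < m, C i ≠ N k := by
    intro k hsk hk i hi hik
    by_cases his : i ≤ s
    · rw [(hprefix i his).2] at hik
      have := hN i (by omega) k hk hik
      omega
    · exact hsuffix (m - i - 1) i (by omega) (by omega) k hk hik
  set g : ℕ → Fin n := fun k => if k < m then C k else N (k - m + (s + 1)) with hg
  have hginj : ∀ i < m + (ℓ - (s + 1)), ∀ k < m + (ℓ - (s + 1)), g i = g k → i = k := by
    intro i hi k hk hik
    simp only [hg] at hik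
    split_ifs at hik with h1 h2 h2
    · exact hC i h1 k h2 hik
    · exact absurd hik (hdisj _ (by omega) (by omega) i h1)
    · exact absurd hik.symm (hdisj _ (by omega) (by omega) k h2)
    · have := hN _ (by omega) _ (by omega) hik
      omega
  have hgsurj : (Finset.range (m + (ℓ - (s + 1)))).image g = Finset.univ := by
    refine Finset.eq_univ_of_forall fun v => Finset.mem_image.2 ?_
    have hCv : ∀ k < m, v = C k → ∃ a ∈ Finset.range (m + (ℓ - (s + 1))), g a = v := by
      rintro k hk rfl
      exact ⟨k, Finset.mem_range.2 (by omega), by simp [hg, hk]⟩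
    rcases hall v with ⟨k, hk, hv⟩ | ⟨k, hk, hv⟩
    · exact hCv k hk hv
    · by_cases hks : k ≤ s
      · exact hCv k (hprefix k hks).1 (by rw [hv, (hprefix k hks).2])
      · refine ⟨k - (s + 1) + m, Finset.mem_range.2 (by omega), ?_⟩
        simp only [hg]
        rw [if_neg (by omega), hv]
        congr 1
        omega
  have hcardn : m + (ℓ - (s + 1)) = n := by
    have h1 := congrArg Finset.card hgsurj
    rw [Finset.card_image_of_injOn, Finset.card_range, Finset.card_univ, Fintype.card_fin] at h1
    · exact h1
    · intro i hi k hk hik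
      exact hginj i (by simpa using hi) k (by simpa using hk) hik
  obtain ⟨σ, hσ⟩ := exists_perm_of_injOn g (by rwa [hcardn] at hginj)
  have hCσ : ∀ k < m, C k = nodeAt σ k := by
    intro k hk
    rw [hσ k (by omega)]
    simp [hg, hk]
  have hNσ : ∀ k < ℓ, N k = nodeAt σ (noosePos m s k) := by
    intro k hk
    unfold noosePos
    split_ifs with hks
    · rw [← (hprefix k hks).2, hCσ k (hprefix k hks).1]
    · rw [hσ _ (by omega)]
      simp only [hg]
      rw [if_neg (by omega)]
      congr 1
      omega
  have hz : nodeAt σ 0 = 0 := by rw [← hCσ 0 (by omega), hC0]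
  have hconf : IsConfig n m s (noosePos m s j) := by
    refine ⟨hm, hmn, hsm, ?_⟩
    unfold noosePos
    split_ifs <;> omega
  refine ⟨σ, s, noosePos m s j, by simpa [nodeAt] using hz, hconf, ?_, by omega, hCσ, hNσ, rfl⟩
  ext e
  rw [hS, Finset.mem_coe, hconf.mem_configGraph_iff (by omega) hCσ (by rw [hCm, hz]) hNσ
    (by rw [hNℓ, hNσ j (by omega)])]

end Lists

/-! ### Types 1 to 3 in terms of the code -/

section Types

variable {n : ℕ} [NeZero n] {σ : Equiv.Perm (Fin n)} {m s w : ℕ}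

lemma exists_config_of_isShortCycleUnionNoose {S : Set (Arc (Fin n))} {vs us ws : List (Fin n)}
    {x : Fin n} (h : IsShortCycleUnionNoose 0 S vs us x ws) (hdeg : EveryInDegreePos S)
    (hcard : S.ncard ≤ n + 1) :
    ∃ (σ : Equiv.Perm (Fin n)) (m s w : ℕ), σ 0 = 0 ∧ IsConfig n m s w ∧ S = configGraph σ m s w ∧
      (∀ v, v ∈ 0 :: vs ↔ ∃ k < m, v = nodeAt σ k) ∧
      (m ≤ w → ∀ v, v ∈ x :: ws ↔ ∃ k < n, w ≤ k ∧ v = nodeAt σ k) ∧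
      (w < m → ∃ v, v ∈ 0 :: vs ∧ v ∈ x :: ws) := by
  obtain ⟨⟨hvs, hcnd, hclt⟩, ⟨hws, hnnd⟩, hS⟩ := h
  set c : List (Fin n) := 0 :: vs with hc
  set ν : List (Fin n) := 0 :: us ++ x :: ws with hν
  have hvs' : 1 ≤ vs.length := List.length_pos_iff.2 hvs
  have hws' : 1 ≤ ws.length := List.length_pos_iff.2 hws
  have hclen : c.length = vs.length + 1 := by simp [hc]
  have hνlen : ν.length = us.length + 1 + (ws.length + 1) := by simp [hν]; omega
  rw [Fintype.card_fin] at hclt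
  have hNj : ν.getD (us.length + 1) x = x := by
    simp [hν]
  have hS' : ∀ e, e ∈ S ↔
      (∃ k < c.length, e.tail = c.getD k 0 ∧ e.head = c.getD (k + 1) 0) ∨
      ∃ k < ν.length, e.tail = ν.getD k x ∧ e.head = ν.getD (k + 1) x := by
    intro e
    rw [hS, Set.mem_union, mem_walkArcs_concat, mem_walkArcs_concat]
  have hCm : c.getD c.length 0 = 0 := List.getD_eq_default _ _ le_rfl
  have hNℓ : ν.getD ν.length x = x := List.getD_eq_default _ _ le_rfl
  have hinjC : ∀ i < c.length, ∀ k < c.length, c.getD i 0 = c.getD k 0 → i = k :=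
    fun i hi k hk => getD_inj hcnd hi hk
  have hinjN : ∀ i < ν.length, ∀ k < ν.length, ν.getD i x = ν.getD k x → i = k :=
    fun i hi k hk => getD_inj hnnd hi hk
  obtain ⟨σ, s, w, hσ, hconf, hSσ, hlen, hCσ, hNσ, hw⟩ := exists_config (m := c.length)
    (ℓ := ν.length) (C := fun k => c.getD k 0) (N := fun k => ν.getD k x) (j := us.length + 1)
    hS' hcard (by
      intro v
      -- Positive in-degree makes every node the head of an arc of one of the walks. An index past
      -- the end means the closing node: the root for the cycle, `x` for the noose.
      obtain ⟨e, he, rfl⟩ := hdeg v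
      rcases (hS' e).1 he with ⟨k, hk, -, h⟩ | ⟨k, hk, -, h⟩
      · left
        by_cases hkc : k + 1 < c.length
        · exact ⟨k + 1, hkc, h⟩
        · refine ⟨0, by omega, ?_⟩
          rw [h, List.getD_eq_default _ _ (by omega)]; rfl
      · right
        by_cases hkc : k + 1 < ν.length
        · exact ⟨k + 1, hkc, h⟩
        · refine ⟨us.length + 1, by omega, ?_⟩
          rw [h, List.getD_eq_default _ _ (by omega)]; exact hNj.symm)
    (by omega) (by omega) hinjC hinjN rfl hCm rfl (by omega) (by omega)
    (by rw [hNℓ, hNj])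
    (by
      intro k hk h
      by_cases hkc : k + 1 < ν.length
      · have := hinjN _ hkc _ hk h; omega
      · have h1 : ν.getD (k + 1) x = x := List.getD_eq_default _ _ (by omega)
        have h2 := hinjN (us.length + 1) (by omega) k hk (by rw [hNj, ← h, h1])
        omega)
    (by
      intro k hk h
      by_cases hkc : k + 1 < c.length
      · have := hinjC _ hkc _ hk h; omega
      · have h1 : c.getD (k + 1) 0 = 0 := List.getD_eq_default _ _ (by omega)
        have h2 := hinjC 0 (by omega) k hk (by
          have h3 : c.getD 0 0 = 0 := rfl
          rw [← h, h1, h3])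
        omega)
  obtain ⟨h1, h2, h3, h4⟩ := id hconf
  have hcmem : ∀ v, v ∈ c ↔ ∃ k < c.length, v = nodeAt σ k := by
    intro v
    rw [mem_iff_getD 0]
    exact exists_congr fun k => and_congr_right fun hk => by rw [← hCσ k hk]
  have hxmem : ∀ v, v ∈ x :: ws ↔ ∃ k < ν.length, us.length + 1 ≤ k ∧ v = ν.getD k x := by
    have hdrop : ∀ k, (x :: ws).getD k x = ν.getD (us.length + 1 + k) x := by
      intro k
      rw [hν, List.getD_append_right _ _ _ _ (by simp)]
      congr 1
      simp
    intro v
    rw [mem_iff_getD x]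
    constructor
    · rintro ⟨k, hk, rfl⟩
      exact ⟨us.length + 1 + k, by simp at hk; omega, by omega, hdrop k⟩
    · rintro ⟨k, hk, hk', rfl⟩
      refine ⟨k - (us.length + 1), by simp; omega, ?_⟩
      rw [hdrop]
      congr 1
      omega
  refine ⟨σ, c.length, s, w, hσ, hconf, hSσ, hcmem, fun hmw v => ?_, fun hwm => ?_⟩
  · have hj : s < us.length + 1 := by
      by_contra hcon
      unfold noosePos at hw
      rw [if_pos (by omega)] at hw
      omega
    unfold noosePos at hw
    rw [if_neg (by omega)] at hw
    rw [hxmem]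
    constructor
    · rintro ⟨k, hk, hk', rfl⟩
      refine ⟨k - (s + 1) + c.length, by omega, by omega, ?_⟩
      rw [hNσ k hk, noosePos, if_neg (by omega)]
    · rintro ⟨k, hk, hk', rfl⟩
      refine ⟨k - c.length + (s + 1), by omega, by omega, ?_⟩
      rw [hNσ _ (by omega), noosePos, if_neg (by omega)]
      congr 1
      omega
  · refine ⟨x, ?_, List.mem_cons_self⟩
    rw [hcmem]
    refine ⟨w, hwm, ?_⟩
    have := hNσ (us.length + 1) (by omega)
    rw [← hw] at this
    exact hNj.symm.trans this

lemma IsConfig.exists_isShortCycleUnionNoose (h : IsConfig n m s w) (hσ : σ 0 = 0) :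
    ∃ vs us ws, IsShortCycleUnionNoose 0 (configGraph σ m s w : Set (Arc (Fin n))) vs us
        (nodeAt σ w) ws ∧
      (∀ v, v ∈ 0 :: vs ↔ ∃ k < m, v = nodeAt σ k) ∧
      (m ≤ w → ∀ v, v ∈ nodeAt σ w :: ws ↔ ∃ k < n, w ≤ k ∧ v = nodeAt σ k) := by
  obtain ⟨h1, h2, h3, h4⟩ := id h
  have hz := nodeAt_zero hσ
  obtain ⟨ℓ, hℓ⟩ : ∃ ℓ, m + ℓ = n + s + 1 := ⟨n + s + 1 - m, by omega⟩
  obtain ⟨j, hj1, hjl, hjw⟩ : ∃ j, 1 ≤ j ∧ j + 2 ≤ ℓ ∧ noosePos m s j = w := by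
    rcases h4 with h4 | h4
    · exact ⟨w, by omega, by omega, if_pos h4.2⟩
    · refine ⟨w - m + (s + 1), by omega, by omega, ?_⟩
      rw [noosePos, if_neg (by omega)]
      omega
  set N : ℕ → Fin n := fun k => nodeAt σ (noosePos m s k) with hN
  have hNj : N j = nodeAt σ w := by simp only [hN, hjw]
  have hclist : (0 : Fin n) :: (List.range' 1 (m - 1)).map (nodeAt σ) =
      (List.range m).map (nodeAt σ) := by
    rw [← cons_map_range' _ (show 0 < m by omega), hz]
  have hwlist : nodeAt σ w :: (List.range' (j + 1) (ℓ - j - 1)).map N =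
      (List.range' j (ℓ - j)).map N := by
    rw [← hNj, show ℓ - j = (ℓ - j - 1) + 1 by omega, List.range'_succ]
    simp
  have hνlist : 0 :: (List.range' 1 (j - 1)).map N ++
      nodeAt σ w :: (List.range' (j + 1) (ℓ - j - 1)).map N = (List.range ℓ).map N := by
    have h0 : (0 : Fin n) = N 0 := by simp [hN, noosePos, hz]
    rw [hwlist, h0, cons_map_range' _ (show 0 < j by omega), ← List.map_append,
      List.range_eq_range', List.range_eq_range']
    congr 1
    have := List.range'_append (s := 0) (m := j) (n := ℓ - j) (step := 1)
    simp only [one_mul, zero_add] at this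
    rw [this]
    congr 1
    omega
  refine ⟨(List.range' 1 (m - 1)).map (nodeAt σ), (List.range' 1 (j - 1)).map N,
    (List.range' (j + 1) (ℓ - j - 1)).map N, ⟨⟨?_, ?_, ?_⟩, ⟨?_, ?_⟩, ?_⟩, ?_, ?_⟩
  · rw [Ne, ← List.length_eq_zero_iff]
    simp only [List.length_map, List.length_range']
    omega
  · rw [hclist]
    exact nodup_map_range fun i hi k hk => (nodeAt_inj (by omega) (by omega)).1
  · simp only [List.length_map, List.length_range', Fintype.card_fin]
    omega
  · rw [Ne, ← List.length_eq_zero_iff]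
    simp only [List.length_map, List.length_range']
    omega
  · rw [hνlist]
    refine nodup_map_range fun i hi k hk hik => ?_
    have := (nodeAt_inj (by unfold noosePos; split_ifs <;> omega)
      (by unfold noosePos; split_ifs <;> omega)).1 hik
    unfold noosePos at this
    split_ifs at this <;> omega
  · ext e
    rw [hclist, hνlist, Set.mem_union, mem_walkArcs_concat, mem_walkArcs_concat, Finset.mem_coe,
      h.mem_configGraph_iff (ℓ := ℓ) (C := fun k => if k < m then nodeAt σ k else 0)
        (N := fun k => if k < ℓ then N k else nodeAt σ w) hℓ (fun k hk => by simp [hk])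
        (by simp [hz]) (fun k hk => by simp [hk, hN]) (by simp)]
    simp only [List.length_map, List.length_range, getD_map_range]
  · intro v
    rw [hclist, List.mem_map]
    simp only [List.mem_range, eq_comm]
  · intro hmw v
    rw [hwlist, List.mem_map]
    unfold noosePos at hjw
    have hjs : ¬ j ≤ s := by
      intro hcon
      rw [if_pos hcon] at hjw
      omega
    rw [if_neg hjs] at hjw
    simp only [List.mem_range'_1]
    constructor
    · rintro ⟨k, hk, rfl⟩
      refine ⟨k - (s + 1) + m, by omega, by omega, ?_⟩
      simp only [hN, noosePos]
      rw [if_neg (by omega)]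
    · rintro ⟨k, hk, hk', rfl⟩
      refine ⟨k - m + (s + 1), by omega, ?_⟩
      simp only [hN, noosePos]
      rw [if_neg (by omega)]
      congr 1
      omega

lemma IsConfig.arcs_mem (h : IsConfig n m s w) (v : Fin n) :
    arcTo (cycleMap σ m w) h.cycleMap_ne v ∈ configGraph σ m s w ∧
      arcTo (nooseMap σ m s w) h.nooseMap_ne v ∈ configGraph σ m s w := by
  simp [configGraph]

lemma IsConfig.everyInDegreePos (h : IsConfig n m s w) :
    EveryInDegreePos (configGraph σ m s w : Set (Arc (Fin n))) := by
  obtain ⟨h1, h2, h3, h4⟩ := id h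
  intro v
  obtain ⟨k, hk, rfl⟩ := exists_nodeAt σ v
  by_cases hk0 : k = 0
  · refine ⟨_, (h.arcs_mem (nodeAt σ (m - 1))).1, ?_⟩
    rw [arcTo_head, cycleMap_nodeAt (by omega), nextPos, if_pos (by omega), hk0]
  · by_cases hkm : k = m
    · refine ⟨_, (h.arcs_mem (nodeAt σ s)).2, ?_⟩
      rw [arcTo_head, nooseMap_nodeAt (by omega) (by omega), if_pos rfl, hkm]
    · refine ⟨_, (h.arcs_mem (nodeAt σ (k - 1))).1, ?_⟩
      rw [arcTo_head, cycleMap_nodeAt (by omega), nextPos, if_neg (by omega), if_neg (by omega)]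
      congr 1
      omega

lemma IsConfig.isSplittingNode (h : IsConfig n m s w) :
    IsSplittingNode (configGraph σ m s w : Set (Arc (Fin n))) (nodeAt σ s) := by
  have : {e ∈ (configGraph σ m s w : Set (Arc (Fin n))) | e.tail = nodeAt σ s} =
      {arcTo (cycleMap σ m w) h.cycleMap_ne (nodeAt σ s),
        arcTo (nooseMap σ m s w) h.nooseMap_ne (nodeAt σ s)} := by
    ext e
    simp only [Set.mem_ofPred_eq, Set.mem_insert_iff, Set.mem_singleton_iff, Finset.mem_coe]
    constructor
    · rintro ⟨he, het⟩
      rw [configGraph, mem_pairGraph, het] at he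
      rcases he with he | he
      · exact Or.inl (Arc.ext' het he)
      · exact Or.inr (Arc.ext' het he)
    · rintro (rfl | rfl)
      · exact ⟨(h.arcs_mem _).1, rfl⟩
      · exact ⟨(h.arcs_mem _).2, rfl⟩
  rw [IsSplittingNode, this, Set.ncard_pair]
  intro h'
  exact h.cycleMap_ne_nooseMap (congrArg Arc.head h')

/-- The only arc that leaves the short cycle ends in position `m`. -/
lemma IsConfig.eq_of_mem (h : IsConfig n m s w) {e : Arc (Fin n)} (he : e ∈ configGraph σ m s w)
    {k l : ℕ} (hk : k < m) (hl : m ≤ l) (hln : l < n) (het : e.tail = nodeAt σ k)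
    (heh : e.head = nodeAt σ l) : l = m := by
  obtain ⟨h1, h2, h3, h4⟩ := h
  rw [configGraph, mem_pairGraph, het, heh, cycleMap_nodeAt (by omega),
    nooseMap_nodeAt (by omega) (by omega), nextPos] at he
  rcases he with he | he
  · split_ifs at he
    · have := (nodeAt_inj hln (by omega)).1 he; omega
    · omega
    · have := (nodeAt_inj hln (by omega)).1 he; omega
  · split_ifs at he
    · exact (nodeAt_inj hln (by omega)).1 he
    · have := (nodeAt_inj hln (by omega)).1 he; omega
    · omega
    · have := (nodeAt_inj hln (by omega)).1 he; omega

/-- A link of one arc leaves the short cycle, so it ends in position `m`. This position lies on the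
noose cycle, which occupies the positions from `w` on, exactly when `w = m`. -/
lemma isType1_iff {S : Set (Arc (Fin n))} (hcard : S.ncard ≤ n + 1) :
    IsType1 0 S ↔
      ∃ (σ : Equiv.Perm (Fin n)) (m s w : ℕ),
        σ 0 = 0 ∧ (IsConfig n m s w ∧ w = m) ∧ S = configGraph σ m s w := by
  constructor
  · rintro ⟨hdeg, vs, us, x, ws, hun, hdis, a, ha, b, hb, -, -, -, hch⟩
    obtain ⟨σ, m, s, w, hσ, hc, hS, hC, hW, hcom⟩ :=
      exists_config_of_isShortCycleUnionNoose hun hdeg hcard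
    have hmw : m ≤ w := by
      by_contra hcon
      obtain ⟨v, hv1, hv2⟩ := hcom (not_le.1 hcon)
      exact hdis hv1 hv2
    refine ⟨σ, m, s, w, hσ, ⟨hc, ?_⟩, hS⟩
    obtain ⟨k, hk, rfl⟩ := (hC a).1 ha
    obtain ⟨l, hl, hwl, rfl⟩ := (hW hmw b).1 hb
    simp only [List.nil_append, List.isChain_cons_cons, List.cons_append] at hch
    obtain ⟨⟨e, he, het, heh⟩, -⟩ := hch
    rw [hS] at he
    have := hc.eq_of_mem he hk (hmw.trans hwl) hl het heh
    omega
  · rintro ⟨σ, m, s, w, hσ, ⟨hc, rfl⟩, rfl⟩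
    obtain ⟨h1, h2, h3, h4⟩ := id hc
    obtain ⟨vs, us, ws, hun, hC, hW⟩ := hc.exists_isShortCycleUnionNoose hσ
    refine ⟨hc.everyInDegreePos, vs, us, _, ws, hun, ?_, ?_⟩
    · intro v hv1 hv2
      obtain ⟨k, hk, rfl⟩ := (hC v).1 hv1
      obtain ⟨l, hl, hwl, hkl⟩ := (hW le_rfl _).1 hv2
      have := (nodeAt_inj (by omega) hl).1 hkl
      omega
    · refine ⟨nodeAt σ s, (hC _).2 ⟨s, h3, rfl⟩, nodeAt σ w, List.mem_cons_self,
        hc.isSplittingNode, List.nodup_nil, by simp, ?_⟩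
      simp only [List.nil_append, List.isChain_cons_cons, List.cons_append, List.isChain_singleton,
        and_true]
      refine ⟨_, (hc.arcs_mem (nodeAt σ s)).2, rfl, ?_⟩
      rw [arcTo_head, nooseMap_nodeAt (by omega) (by omega), if_pos rfl]

/-- The first inner node of the link is at position `m` and lies off the noose cycle, so `m < w`.
Conversely, the positions `m, …, w - 1` are the inner nodes of a link. -/
lemma isType2_iff {S : Set (Arc (Fin n))} (hcard : S.ncard ≤ n + 1) :
    IsType2 0 S ↔
      ∃ (σ : Equiv.Perm (Fin n)) (m s w : ℕ),
        σ 0 = 0 ∧ (IsConfig n m s w ∧ m < w) ∧ S = configGraph σ m s w := by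
  constructor
  · rintro ⟨hdeg, vs, us, x, ws, hun, hdis, ms, hms, a, ha, b, hb, -, -, hin, hch⟩
    obtain ⟨σ, m, s, w, hσ, hc, hS, hC, hW, hcom⟩ :=
      exists_config_of_isShortCycleUnionNoose hun hdeg hcard
    have hmw : m ≤ w := by
      by_contra hcon
      obtain ⟨v, hv1, hv2⟩ := hcom (not_le.1 hcon)
      exact hdis hv1 hv2
    refine ⟨σ, m, s, w, hσ, ⟨hc, ?_⟩, hS⟩
    obtain ⟨k, hk, rfl⟩ := (hC a).1 ha
    obtain ⟨c, ms, rfl⟩ := List.exists_cons_of_ne_nil hms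
    simp only [List.isChain_cons_cons, List.cons_append] at hch
    obtain ⟨⟨e, he, het, heh⟩, -⟩ := hch
    obtain ⟨hc1, hc2⟩ := hin c List.mem_cons_self
    obtain ⟨l, hl, rfl⟩ := exists_nodeAt σ c
    have hml : m ≤ l := by
      by_contra hcon
      exact hc1 ((hC _).2 ⟨l, not_le.1 hcon, rfl⟩)
    rw [hS] at he
    have := hc.eq_of_mem he hk hml hl het heh
    by_contra hcon
    exact hc2 ((hW hmw _).2 ⟨l, hl, by omega, rfl⟩)
  · rintro ⟨σ, m, s, w, hσ, ⟨hc, hmw⟩, rfl⟩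
    obtain ⟨h1, h2, h3, h4⟩ := id hc
    obtain ⟨vs, us, ws, hun, hC, hW⟩ := hc.exists_isShortCycleUnionNoose hσ
    refine ⟨hc.everyInDegreePos, vs, us, _, ws, hun, ?_, (List.range' m (w - m)).map (nodeAt σ),
      ?_, ?_⟩
    · intro v hv1 hv2
      obtain ⟨k, hk, rfl⟩ := (hC v).1 hv1
      obtain ⟨l, hl, hwl, hkl⟩ := (hW hmw.le _).1 hv2
      have := (nodeAt_inj (by omega) hl).1 hkl
      omega
    · rw [Ne, ← List.length_eq_zero_iff]
      simp only [List.length_map, List.length_range']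
      omega
    · refine ⟨nodeAt σ s, (hC _).2 ⟨s, h3, rfl⟩, nodeAt σ w, List.mem_cons_self,
        hc.isSplittingNode, ?_, ?_, ?_⟩
      · refine List.Nodup.map_on (fun i hi k hk hik => ?_) List.nodup_range'
        rw [List.mem_range'_1] at hi hk
        exact (nodeAt_inj (by omega) (by omega)).1 hik
      · intro v hv
        obtain ⟨k, hk, rfl⟩ := List.mem_map.1 hv
        rw [List.mem_range'_1] at hk
        constructor
        · intro hv1
          obtain ⟨l, hl, hkl⟩ := (hC _).1 hv1
          have := (nodeAt_inj (by omega) (by omega)).1 hkl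
          omega
        · intro hv2
          obtain ⟨l, hl, hwl, hkl⟩ := (hW hmw.le _).1 hv2
          have := (nodeAt_inj (by omega) hl).1 hkl
          omega
      · have hlist : (List.range' m (w - m)).map (nodeAt σ) ++ [nodeAt σ w] =
            (List.range' m (w - m + 1)).map (nodeAt σ) := by
          rw [List.range'_concat]
          simp only [List.map_append, List.map_cons, List.map_nil]
          congr 3
          omega
        rw [List.cons_append, hlist, List.range'_succ, List.map_cons, List.isChain_cons_cons]
        constructor
        · refine ⟨_, (hc.arcs_mem (nodeAt σ s)).2, rfl, ?_⟩
          rw [arcTo_head, nooseMap_nodeAt (by omega) (by omega), if_pos rfl]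
        · rw [← List.map_cons, ← List.range'_succ, List.isChain_iff_getElem]
          intro i hi
          simp only [List.length_map, List.length_range'] at hi
          refine ⟨_, (hc.arcs_mem (nodeAt σ (m + i))).1, ?_, ?_⟩
          · simp
          · rw [arcTo_head, cycleMap_nodeAt (by omega), nextPos, if_neg (by omega),
              if_neg (by omega)]
            simp [add_assoc]

lemma isType3_iff {S : Set (Arc (Fin n))} (hcard : S.ncard ≤ n + 1) :
    IsType3 0 S ↔
      ∃ (σ : Equiv.Perm (Fin n)) (m s w : ℕ),
        σ 0 = 0 ∧ (IsConfig n m s w ∧ w ≤ s) ∧ S = configGraph σ m s w := by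
  constructor
  · rintro ⟨hdeg, vs, us, x, ws, hun, v, hv1, hv2⟩
    obtain ⟨σ, m, s, w, hσ, hc, hS, hC, hW, hcom⟩ :=
      exists_config_of_isShortCycleUnionNoose hun hdeg hcard
    obtain ⟨h1, h2, h3, h4⟩ := id hc
    refine ⟨σ, m, s, w, hσ, ⟨hc, ?_⟩, hS⟩
    by_contra hcon
    obtain ⟨k, hk, rfl⟩ := (hC v).1 hv1
    obtain ⟨l, hl, hwl, hkl⟩ := (hW (by omega) _).1 hv2
    have := (nodeAt_inj (by omega) hl).1 hkl
    omega
  · rintro ⟨σ, m, s, w, hσ, ⟨hc, hws⟩, rfl⟩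
    obtain ⟨h1, h2, h3, h4⟩ := id hc
    obtain ⟨vs, us, ws, hun, hC, hW⟩ := hc.exists_isShortCycleUnionNoose hσ
    exact ⟨hc.everyInDegreePos, vs, us, _, ws, hun, nodeAt σ w, (hC _).2 ⟨w, by omega, rfl⟩,
      List.mem_cons_self⟩

lemma card_cycleMap_graph (hn : 2 ≤ n) :
    (Finset.univ.filter fun e : Arc (Fin n) => e.head = cycleMap σ n 0 e.tail).card = n := by
  have hne := cycleMap_ne (σ := σ) hn (show 0 + 2 ≤ n by omega)
  have : (Finset.univ.filter fun e : Arc (Fin n) => e.head = cycleMap σ n 0 e.tail) =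
      Finset.univ.image (arcTo _ hne) := by
    ext e
    simp only [Finset.mem_filter, Finset.mem_univ, true_and, Finset.mem_image]
    constructor
    · intro h
      exact ⟨e.tail, Arc.ext' rfl h.symm⟩
    · rintro ⟨v, rfl⟩
      rfl
  rw [this, Finset.card_image_of_injective, Finset.card_univ, Fintype.card_fin]
  intro u v huv
  exact congrArg Arc.tail huv

/-- The bases whose support is a configuration are exactly the configurations. -/
lemma numBases_eq_ncard_image {β : ℝ} (h0 : 0 < β) (h1 : β < 1)
    {T : Set (Arc (Fin n)) → Prop} {q : ℕ → ℕ → ℕ → Prop}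
    (hT : ∀ S : Set (Arc (Fin n)), S.ncard ≤ n + 1 →
      (T S ↔
        ∃ (σ : Equiv.Perm (Fin n)) (m s w : ℕ),
        σ 0 = 0 ∧ (IsConfig n m s w ∧ q m s w) ∧ S = configGraph σ m s w)) :
    numBases β 0 (fun S => ¬ IsHamiltonianCycle (0 : Fin n) S ∧ T S) =
      {B : Finset (Arc (Fin n)) | ∃ (σ : Equiv.Perm (Fin n)) (m s w : ℕ), σ 0 = 0 ∧
        (IsConfig n m s w ∧ q m s w) ∧ B = configGraph σ m s w}.ncard := by
  unfold numBases
  congr 1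
  ext B
  constructor
  · rintro ⟨x, hx, -, hTx⟩
    have hsub := supportArcs_subset_of_eq_zero hx.2.2.2.2
    have hBcard : (B : Set (Arc (Fin n))).ncard = n + 1 := by
      rw [Set.ncard_coe_finset, hx.2.1, Fintype.card_fin]
    have hcard := Set.ncard_le_ncard hsub (Set.toFinite _)
    obtain ⟨σ, m, s, w, hσ, hq, hS⟩ := (hT _ (hcard.trans hBcard.le)).1 hTx
    refine ⟨σ, m, s, w, hσ, hq, ?_⟩
    rw [hS] at hsub
    -- The support already has `n + 1` arcs, so it fills the basis.
    refine (Finset.eq_of_subset_of_card_le (Finset.coe_subset.1 hsub) ?_).symm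
    rw [hq.1.card_configGraph, hx.2.1, Fintype.card_fin]
  · rintro ⟨σ, m, s, w, hσ, hq, rfl⟩
    obtain ⟨x, hx, hsupp⟩ := hq.1.exists_isFeasibleBasisFor h0 h1 hσ
    have hc : (configGraph σ m s w : Set (Arc (Fin n))).ncard = n + 1 := by
      rw [Set.ncard_coe_finset, hq.1.card_configGraph]
    have hn : 2 ≤ n := hq.1.two_le.trans hq.1.lt.le
    refine ⟨x, hx, ?_, ?_⟩
    · intro hham
      rw [hsupp] at hham
      obtain ⟨τ, -, hτ⟩ := (isHamiltonianCycle_iff hn).1 hham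
      have h2 := card_cycleMap_graph (σ := τ) hn
      rw [← Set.ncard_coe_finset] at h2
      have h3 : ((Finset.univ.filter fun e : Arc (Fin n) => e.head = cycleMap τ n 0 e.tail :
          Finset (Arc (Fin n))) : Set (Arc (Fin n))) = configGraph σ m s w := by
        rw [hτ]; ext e; simp
      rw [h3] at h2
      omega
    · rw [hsupp]
      exact (hT _ hc.le).2 ⟨σ, m, s, w, hσ, hq, rfl⟩

end Types

/-! ### Counting the bases of Types 1 to 3 and the Hamiltonian bases -/

section Counting

variable {n : ℕ} [NeZero n] {σ τ : Equiv.Perm (Fin n)} {β : ℝ}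

/-- The orderings of the nodes that start with the root. -/
def rootedPerms (n : ℕ) [NeZero n] : Finset (Equiv.Perm (Fin n)) :=
  Finset.univ.filter fun σ => σ 0 = 0

@[simp] lemma mem_rootedPerms : σ ∈ rootedPerms n ↔ σ 0 = 0 := by simp [rootedPerms]

lemma card_rootedPerms : (rootedPerms n).card = (n - 1)! := by
  obtain ⟨k, rfl⟩ := Nat.exists_eq_succ_of_ne_zero (NeZero.ne n)
  have : rootedPerms (k + 1) =
      (Finset.univ : Finset (Equiv.Perm (Fin k))).image fun e =>
        Equiv.Perm.decomposeFin.symm (0, e) := by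
    ext σ
    simp only [mem_rootedPerms, Finset.mem_image, Finset.mem_univ, true_and]
    constructor
    · intro h
      refine ⟨(Equiv.Perm.decomposeFin σ).2, ?_⟩
      rw [Equiv.symm_apply_eq]
      refine Prod.ext ?_ rfl
      have h2 := Equiv.Perm.decomposeFin_symm_apply_zero (Equiv.Perm.decomposeFin σ).1
        (Equiv.Perm.decomposeFin σ).2
      rw [Prod.mk.eta, Equiv.symm_apply_apply] at h2
      exact (h2.symm.trans h).symm
    · rintro ⟨e, rfl⟩
      simp
  rw [this, Finset.card_image_of_injective, Finset.card_univ, Fintype.card_perm, Fintype.card_fin]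
  · rfl
  · intro e e' h
    simpa using h

lemma ncard_config {q : ℕ → ℕ → ℕ → Prop} {W : ℕ → ℕ → Finset ℕ}
    (hW : ∀ m s w, IsConfig n m s w ∧ q m s w ↔
      m ∈ Finset.Ico 2 n ∧ s ∈ Finset.range m ∧ w ∈ W m s) :
    {B : Finset (Arc (Fin n)) | ∃ (σ : Equiv.Perm (Fin n)) (m s w : ℕ), σ 0 = 0 ∧
        (IsConfig n m s w ∧ q m s w) ∧ B = configGraph σ m s w}.ncard =
      (n - 1)! * ∑ m ∈ Finset.Ico 2 n, ∑ s ∈ Finset.range m, (W m s).card := by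
  set P : Finset (Equiv.Perm (Fin n) × (Σ _ : ℕ, Σ _ : ℕ, ℕ)) := rootedPerms n ×ˢ
    ((Finset.Ico 2 n).sigma fun m => (Finset.range m).sigma fun s => W m s) with hP
  have hmem : ∀ σ m s w, (σ, (⟨m, s, w⟩ : Σ _ : ℕ, Σ _ : ℕ, ℕ)) ∈ P ↔
      σ 0 = 0 ∧ IsConfig n m s w ∧ q m s w := by
    intro σ m s w
    rw [hW]
    simp [hP]
  have : {B : Finset (Arc (Fin n)) | ∃ (σ : Equiv.Perm (Fin n)) (m s w : ℕ), σ 0 = 0 ∧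
        (IsConfig n m s w ∧ q m s w) ∧ B = configGraph σ m s w} =
      ((P.image fun p => configGraph p.1 p.2.1 p.2.2.1 p.2.2.2 : Finset (Finset (Arc (Fin n)))) :
        Set (Finset (Arc (Fin n)))) := by
    ext B
    simp only [Set.mem_ofPred_eq, Finset.coe_image, Set.mem_image, Finset.mem_coe]
    constructor
    · rintro ⟨σ, m, s, w, h1, h2, rfl⟩
      exact ⟨(σ, ⟨m, s, w⟩), (hmem _ _ _ _).2 ⟨h1, h2⟩, rfl⟩
    · rintro ⟨⟨σ, ⟨m, s, w⟩⟩, h, rfl⟩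
      obtain ⟨h1, h2⟩ := (hmem _ _ _ _).1 h
      exact ⟨σ, m, s, w, h1, h2, rfl⟩
  rw [this, Set.ncard_coe_finset, Finset.card_image_of_injOn]
  · rw [hP, Finset.card_product, card_rootedPerms, Finset.card_sigma]
    simp only [Finset.card_sigma]
  · rintro ⟨σ, ⟨m, s, w⟩⟩ h ⟨σ', ⟨m', s', w'⟩⟩ h' heq
    obtain ⟨h1, h2, -⟩ := (hmem _ _ _ _).1 (Finset.mem_coe.1 h)
    obtain ⟨h1', h2', -⟩ := (hmem _ _ _ _).1 (Finset.mem_coe.1 h')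
    obtain ⟨rfl, rfl, rfl, rfl⟩ := configGraph_inj h1 h1' h2 h2' heq
    rfl

lemma sum_Ico_id (k : ℕ) : ∑ m ∈ Finset.Ico 2 (k + 2), (m : ℝ) = (k + 1) * (k + 2) / 2 - 1 := by
  induction k with
  | zero => norm_num
  | succ k ih =>
    rw [Finset.sum_Ico_succ_top (by omega), ih]
    push_cast
    ring

lemma sum_Ico_sq (k : ℕ) :
    ∑ m ∈ Finset.Ico 2 (k + 2), (m : ℝ) ^ 2 = (k + 1) * (k + 2) * (2 * k + 3) / 6 - 1 := by
  induction k with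
  | zero => norm_num
  | succ k ih =>
    rw [Finset.sum_Ico_succ_top (by omega), ih]
    push_cast
    ring

lemma numBases_type1 (hn : 3 ≤ n) (h0 : 0 < β) (h1 : β < 1) :
    (numBases β 0 (fun S => ¬ IsHamiltonianCycle (0 : Fin n) S ∧ IsType1 0 S) : ℝ) =
      1 / 2 * ((n : ℝ) - 3) * (n ! : ℝ) := by
  rw [numBases_eq_ncard_image (q := fun m _ w => w = m) h0 h1 fun _ => isType1_iff,
    -- The only choice is `w = m`, and none is left for `m = n - 1`, where `w + 2 ≤ n` fails; the
    -- minimum encodes both.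
    ncard_config (W := fun m _ => Finset.Ico m (min (m + 1) (n - 1)))]
  · obtain ⟨k, hk⟩ := Nat.exists_eq_add_of_le hn
    have hsum : ∑ m ∈ Finset.Ico 2 n, ∑ _s ∈ Finset.range m,
        (Finset.Ico m (min (m + 1) (n - 1))).card = ∑ m ∈ Finset.Ico 2 (k + 2), m := by
      rw [show n = k + 2 + 1 by omega, Finset.sum_Ico_succ_top (by omega)]
      simp only [Nat.card_Ico, Finset.sum_const, Finset.card_range, smul_eq_mul,
        Nat.add_sub_cancel]
      rw [show min (k + 2 + 1) (k + 2) - (k + 2) = 0 by omega, mul_zero, add_zero]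
      refine Finset.sum_congr rfl fun m hm => ?_
      rw [Finset.mem_Ico] at hm
      rw [show min (m + 1) (k + 2) - m = 1 by omega, mul_one]
    rw [hsum, ← Nat.mul_factorial_pred (show n ≠ 0 by omega), hk]
    push_cast
    rw [sum_Ico_id]
    ring
  · intro m s w
    simp only [Finset.mem_Ico, Finset.mem_range, lt_min_iff]
    constructor
    · rintro ⟨⟨h1, h2, h3, h4⟩, h5⟩; omega
    · intro h
      exact ⟨⟨by omega, by omega, by omega, by omega⟩, by omega⟩

/-- There are `m` choices of `s` and `n - 2 - m` of `w`, so the sum is over `m * (n - 2 - m)`. -/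
lemma numBases_type2 (hn : 3 ≤ n) (h0 : 0 < β) (h1 : β < 1) :
    (numBases β 0 (fun S => ¬ IsHamiltonianCycle (0 : Fin n) S ∧ IsType2 0 S) : ℝ) =
      1 / 6 * ((n : ℝ) - 4) * ((n : ℝ) - 3) * ((n : ℝ) + 1) * ((n - 1)! : ℝ) := by
  rw [numBases_eq_ncard_image (q := fun m _ w => m < w) h0 h1 fun _ => isType2_iff,
    ncard_config (W := fun m _ => Finset.Ico (m + 1) (n - 1))]
  · obtain ⟨k, hk⟩ := Nat.exists_eq_add_of_le hn
    have hsum : ((∑ m ∈ Finset.Ico 2 n, ∑ _s ∈ Finset.range m,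
        (Finset.Ico (m + 1) (n - 1)).card : ℕ) : ℝ) =
          ∑ m ∈ Finset.Ico 2 (k + 2), ((k + 1) * (m : ℝ) - (m : ℝ) ^ 2) := by
      rw [show n = k + 2 + 1 by omega, Finset.sum_Ico_succ_top (by omega)]
      simp only [Nat.card_Ico, Finset.sum_const, Finset.card_range, smul_eq_mul,
        Nat.add_sub_cancel]
      rw [show k + 2 - (k + 2 + 1) = 0 by omega, mul_zero, add_zero]
      push_cast
      refine Finset.sum_congr rfl fun m hm => ?_
      rw [Finset.mem_Ico] at hm
      rw [Nat.cast_sub (by omega)]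
      push_cast
      ring
    rw [Nat.cast_mul, hsum, Finset.sum_sub_distrib, ← Finset.mul_sum, sum_Ico_id, sum_Ico_sq, hk]
    push_cast
    ring
  · intro m s w
    simp only [Finset.mem_Ico, Finset.mem_range]
    constructor
    · rintro ⟨⟨h1, h2, h3, h4⟩, h5⟩; omega
    · intro h
      exact ⟨⟨by omega, by omega, by omega, by omega⟩, by omega⟩

/-- For given `s` there are `s` choices of `w`, so each `m` contributes `m * (m - 1) / 2`. -/
lemma numBases_type3 (hn : 3 ≤ n) (h0 : 0 < β) (h1 : β < 1) :
    (numBases β 0 (fun S => ¬ IsHamiltonianCycle (0 : Fin n) S ∧ IsType3 0 S) : ℝ) =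
      1 / 6 * ((n : ℝ) - 2) * ((n : ℝ) - 1) * (n ! : ℝ) := by
  rw [numBases_eq_ncard_image (q := fun _ s w => w ≤ s) h0 h1 fun _ => isType3_iff,
    ncard_config (W := fun _ s => Finset.Icc 1 s)]
  · obtain ⟨k, hk⟩ := Nat.exists_eq_add_of_le hn
    have hgauss : ∀ m : ℕ, ∑ s ∈ Finset.range m, (s : ℝ) = ((m : ℝ) ^ 2 - m) / 2 := by
      intro m
      induction m with
      | zero => simp
      | succ m ih => rw [Finset.sum_range_succ, ih]; push_cast; ring
    have hsum : ((∑ m ∈ Finset.Ico 2 n, ∑ s ∈ Finset.range m,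
        (Finset.Icc 1 s).card : ℕ) : ℝ) =
          ∑ m ∈ Finset.Ico 2 (k + 1 + 2), (((m : ℝ) ^ 2 - m) / 2) := by
      rw [show n = k + 1 + 2 by omega]
      push_cast
      refine Finset.sum_congr rfl fun m _ => ?_
      rw [← hgauss]
      simp
    rw [Nat.cast_mul, hsum, ← Finset.sum_div, Finset.sum_sub_distrib, sum_Ico_id, sum_Ico_sq,
      ← Nat.mul_factorial_pred (show n ≠ 0 by omega), hk]
    push_cast
    ring
  · intro m s w
    simp only [Finset.mem_Ico, Finset.mem_range, Finset.mem_Icc]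
    constructor
    · rintro ⟨⟨h1, h2, h3, h4⟩, h5⟩; omega
    · intro h
      exact ⟨⟨by omega, by omega, by omega, by omega⟩, by omega⟩

/-- The arcs of the Hamiltonian cycle that visits the nodes in the order `σ`. -/
def cycleGraph (σ : Equiv.Perm (Fin n)) : Finset (Arc (Fin n)) :=
  Finset.univ.filter fun e => e.head = cycleMap σ n 0 e.tail

@[simp] lemma mem_cycleGraph {e : Arc (Fin n)} :
    e ∈ cycleGraph σ ↔ e.head = cycleMap σ n 0 e.tail := by simp [cycleGraph]

lemma cycleMap_surjective : Function.Surjective (cycleMap σ n 0) := by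
  intro v
  obtain ⟨k, hk, rfl⟩ := exists_nodeAt σ v
  by_cases hk0 : k = 0
  · refine ⟨nodeAt σ (n - 1), ?_⟩
    rw [cycleMap_nodeAt (by omega), nextPos, if_pos (by omega), hk0]
  · refine ⟨nodeAt σ (k - 1), ?_⟩
    rw [cycleMap_nodeAt (by omega), nextPos, if_neg (by omega), if_neg (by omega)]
    congr 1
    omega

/-- A map for which the root has the full period is injective. -/
lemma injective_of_period {f : Fin n → Fin n} {r : Fin n} (hm : f^[n] r = r)
    (h : ∀ t, 0 < t → t < n → f^[t] r ≠ r) : Function.Injective f := by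
  have hlt : ∀ i < n, ∀ j < n, i < j → f^[i] r ≠ f^[j] r := by
    intro i hi j hj hij heq
    -- Applying `f^[n - j]` to both sides turns a repetition into a return to the root before time
    -- `n`.
    refine h (n - j + i) (by omega) (by omega) ?_
    rw [Function.iterate_add_apply, heq, ← Function.iterate_add_apply,
      show n - j + j = n by omega, hm]
  have hinj : Function.Injective fun k : Fin n => f^[(k : ℕ)] r := by
    intro i j hij
    rcases lt_trichotomy (i : ℕ) (j : ℕ) with h1 | h1 | h1
    · exact absurd hij (hlt i i.2 j j.2 h1)
    · exact Fin.ext h1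
    · exact absurd hij.symm (hlt j j.2 i i.2 h1)
  rw [Finite.injective_iff_surjective]
  intro v
  obtain ⟨k, rfl⟩ := (Finite.injective_iff_surjective.1 hinj) v
  by_cases hk : (k : ℕ) = 0
  · refine ⟨f^[n - 1] r, ?_⟩
    have hn := NeZero.ne n
    rw [← Function.iterate_succ_apply' f, show (n - 1).succ = n by omega, hm]
    simp [hk]
  · refine ⟨f^[(k : ℕ) - 1] r, ?_⟩
    rw [← Function.iterate_succ_apply' f, show ((k : ℕ) - 1).succ = k by omega]

/-- The occupation of the root determines its return time. The value `1 / (1 - β ^ n)` would mean a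
first return at time `n`, so the orbit of the root would be everything and `f` a permutation. -/
lemma occupation_ne_of_not_injective (h0 : 0 < β) (h1 : β < 1) {f : Fin n → Fin n} {r : Fin n}
    (hf : ¬ Function.Injective f) : occupation β r f r ≠ 1 / (1 - β ^ n) := by
  have hbn : 0 < β ^ n := by positivity
  have hbn1 : β ^ n < 1 := pow_lt_one₀ h0.le h1 (NeZero.ne n)
  by_cases hex : ∃ t, f^[t + 1] r = r
  · classical
    have hP := Nat.find_spec hex
    set P := Nat.find hex + 1 with hPdef
    have hmin : ∀ t, 0 < t → t < P → f^[t] r ≠ r := by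
      intro t ht htP
      have := Nat.find_min hex (m := t - 1) (by omega)
      rwa [show t - 1 + 1 = t by omega] at this
    rw [occupation_root_of_period h0 h1 (m := P) (by omega) hP hmin]
    intro heq
    have hbP1 : β ^ P < 1 := pow_lt_one₀ h0.le h1 (by omega)
    rw [div_eq_div_iff (by linarith) (by linarith)] at heq
    have hPn : P = n := by
      refine pow_right_injective₀ h0 h1.ne ?_
      simp only
      linarith
    rw [hPn] at hP hmin
    exact hf (injective_of_period hP hmin)
  · push Not at hex
    rw [occupation_root_of_ne hex, Ne, eq_comm, div_eq_one_iff_eq (by linarith)]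
    intro h
    linarith

/-- Redirecting the tail of `e` along `e` leaves two preimages of its head, so the modified map has
another root outflow and the two maps are independent. The flow of the cycle is zero on `e`: the
basis is degenerate. -/
lemma exists_isFeasibleBasisFor_insert (hn : 2 ≤ n) (h0 : 0 < β) (h1 : β < 1) (hσ : σ 0 = 0)
    {e : Arc (Fin n)} (he : e ∉ cycleGraph σ) :
    ∃ x, IsFeasibleBasisFor β 0 Set.univ (insert e (cycleGraph σ)) x ∧
      supportArcs x = cycleGraph σ := by
  rw [mem_cycleGraph] at he
  have hne := cycleMap_ne (σ := σ) hn (show 0 + 2 ≤ n by omega)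
  set f := cycleMap σ n 0 with hf
  set f' : Fin n → Fin n := Function.update f e.tail e.head with hf'
  have hoff : ∀ v, v ≠ e.tail → f v = f' v := fun v hv => by simp [hf', hv]
  have hat : f' e.tail = e.head := by simp [hf']
  have hne' : ∀ v, f' v ≠ v := by
    intro v
    by_cases hv : v = e.tail
    · rw [hv, hat]
      exact e.tail_ne_head.symm
    · rw [← hoff v hv]
      exact hne v
  have hgraph : insert e (cycleGraph σ) = pairGraph f f' := by
    ext a
    simp only [Finset.mem_insert, mem_cycleGraph, mem_pairGraph]
    constructor
    · rintro (rfl | h)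
      · exact Or.inr hat.symm
      · exact Or.inl h
    · rintro (h | h)
      · exact Or.inr h
      · by_cases ha : a.tail = e.tail
        · exact Or.inl (Arc.ext' ha (by rw [h, ha, hat]))
        · exact Or.inr (by rw [h, ← hoff _ ha])
  have hocc : occupation β 0 f 0 = 1 / (1 - β ^ n) :=
    occupation_cycleMap h0 h1 hσ (by omega) le_rfl
  have hocc' : occupation β 0 f' 0 ≠ 1 / (1 - β ^ n) := by
    refine occupation_ne_of_not_injective h0 h1 fun hinj => ?_
    obtain ⟨u, hu⟩ := cycleMap_surjective (σ := σ) e.head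
    have hue : u ≠ e.tail := by
      rintro rfl
      exact he hu.symm
    refine hue (hinj ?_)
    rw [← hoff u hue, hat]
    exact hu
  have hx := mem_hPolytope_flow (r := 0) h0 h1 hne (by rwa [Fintype.card_fin])
  set x := (1 - β ^ Fintype.card (Fin n)) • flow β 0 f with hxdef
  have hn0 : 0 < 1 - β ^ Fintype.card (Fin n) := by
    rw [Fintype.card_fin]
    exact sub_pos.2 (pow_lt_one₀ h0.le h1 (by omega))
  have hsupp : supportArcs x = cycleGraph σ := by
    ext a
    simp only [supportArcs, Set.mem_ofPred_eq, Finset.mem_coe, mem_cycleGraph, hxdef,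
      Pi.smul_apply, smul_eq_mul, flow]
    constructor
    · intro h
      by_contra h'
      rw [if_neg h', mul_zero] at h
      exact lt_irrefl _ h
    · intro h
      rw [if_pos h]
      obtain ⟨k, hk, hka⟩ := exists_nodeAt σ a.tail
      refine mul_pos hn0 (occupation_pos h0 h1 (t := k) ?_)
      rw [← hka, ← nodeAt_zero hσ]
      exact iterate_cycleMap le_rfl hk
  refine ⟨x, ⟨Set.subset_univ _, ?_, ?_, hx, ?_⟩, hsupp⟩
  · rw [hgraph, card_pairGraph (s := e.tail) hne hne' hoff]
    rw [hat]
    exact Ne.symm he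
  · rw [hgraph]
    refine linearIndepOn_pairGraph h0 h1 hne hne' hoff ?_
    rw [hocc]
    exact hocc'.symm
  · refine eq_zero_of_supportArcs_subset hx ?_
    rw [hsupp]
    exact Finset.coe_subset.2 (Finset.subset_insert _ _)

lemma cycleGraph_inj (hn : 2 ≤ n) (hσ : σ 0 = 0) (hτ : τ 0 = 0)
    (h : cycleGraph σ = cycleGraph τ) : σ = τ := by
  have hne := cycleMap_ne (σ := σ) hn (show 0 + 2 ≤ n by omega)
  have hmap : cycleMap σ n 0 = cycleMap τ n 0 := by
    ext1 v
    have h2 : arcTo _ hne v ∈ cycleGraph σ := by simp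
    rw [h, mem_cycleGraph] at h2
    exact h2
  refine perm_ext_nodeAt fun k hk => ?_
  rw [← iterate_cycleMap (w := 0) le_rfl hk, ← iterate_cycleMap (σ := τ) (w := 0) le_rfl hk, hmap,
    nodeAt_zero hσ, nodeAt_zero hτ]

omit [NeZero n] in
lemma card_arc : Fintype.card (Arc (Fin n)) = n * n - n := by
  rw [Fintype.card_subtype]
  have : (Finset.univ.filter fun e : Fin n × Fin n => e.1 ≠ e.2) =
      (Finset.univ : Finset (Fin n)).offDiag := by
    ext e; simp
  rw [this, Finset.offDiag_card]
  simp

/-- A basis is a Hamiltonian cycle plus one arbitrary arc, chosen among `n * (n - 2)`. The cycle is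
recovered as the support of the unique extreme point. -/
lemma numBases_hamiltonian (hn : 3 ≤ n) (h0 : 0 < β) (h1 : β < 1) :
    (numBases β 0 (IsHamiltonianCycle (0 : Fin n)) : ℝ) = ((n : ℝ) - 2) * (n ! : ℝ) := by
  set P : Finset (Σ _ : Equiv.Perm (Fin n), Arc (Fin n)) :=
    (rootedPerms n).sigma fun σ => (cycleGraph σ)ᶜ with hP
  have hset : {B : Finset (Arc (Fin n)) | ∃ x, IsFeasibleBasisFor β 0 Set.univ B x ∧
      IsHamiltonianCycle 0 (supportArcs x)} =
      ((P.image fun p => insert p.2 (cycleGraph p.1) : Finset (Finset (Arc (Fin n)))) :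
        Set (Finset (Arc (Fin n)))) := by
    ext B
    simp only [Set.mem_ofPred_eq, Finset.coe_image, Set.mem_image, Finset.mem_coe]
    constructor
    · rintro ⟨x, hx, hham⟩
      obtain ⟨σ, hσ, hS⟩ := (isHamiltonianCycle_iff (by omega)).1 hham
      have hsub : cycleGraph σ ⊆ B := by
        have := supportArcs_subset_of_eq_zero hx.2.2.2.2
        intro e he
        refine this ?_
        rw [hS]
        simpa using he
      obtain ⟨e, he, hB⟩ := Finset.exists_eq_insert_iff.2 ⟨hsub, by
        rw [hx.2.1, Fintype.card_fin, cycleGraph, card_cycleMap_graph (by omega)]⟩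
      exact ⟨⟨σ, e⟩, by simp [hP, hσ, mem_cycleGraph.not.1 he], hB⟩
    · rintro ⟨⟨σ, e⟩, h, rfl⟩
      simp only [hP, Finset.mem_sigma, mem_rootedPerms, Finset.mem_compl] at h
      obtain ⟨x, hx, hsupp⟩ := exists_isFeasibleBasisFor_insert (by omega) h0 h1 h.1 h.2
      refine ⟨x, hx, (isHamiltonianCycle_iff (by omega)).2 ⟨σ, h.1, ?_⟩⟩
      rw [hsupp]
      ext e
      simp
  have hinj : Set.InjOn (fun p : Σ _ : Equiv.Perm (Fin n), Arc (Fin n) =>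
      insert p.2 (cycleGraph p.1)) P := by
    rintro ⟨σ, e⟩ h ⟨τ, e'⟩ h' heq
    simp only [hP, Finset.coe_sigma, Set.mem_sigma_iff, Finset.mem_coe, mem_rootedPerms,
      Finset.mem_compl] at h h'
    simp only at heq
    obtain ⟨x, hx, hsupp⟩ := exists_isFeasibleBasisFor_insert (by omega) h0 h1 h.1 h.2
    obtain ⟨y, hy, hsupp'⟩ := exists_isFeasibleBasisFor_insert (by omega) h0 h1 h'.1 h'.2
    rw [← heq] at hy
    have hxy := hx.unique hy
    rw [← hxy, hsupp] at hsupp'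
    have hστ := cycleGraph_inj (by omega) h.1 h'.1 (Finset.coe_injective hsupp')
    subst hστ
    have hee := (Finset.insert_inj h.2).1 heq
    rw [hee]
  have hcompl : ∀ σ : Equiv.Perm (Fin n), ((cycleGraph σ)ᶜ).card = n * n - n - n := by
    intro σ
    rw [Finset.card_compl, card_arc, cycleGraph, card_cycleMap_graph (by omega)]
  rw [numBases, hset, Set.ncard_coe_finset, Finset.card_image_of_injOn hinj, hP,
    Finset.card_sigma]
  simp only [hcompl, Finset.sum_const, smul_eq_mul, card_rootedPerms]
  rw [← Nat.mul_factorial_pred (show n ≠ 0 by omega)]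
  obtain ⟨k, rfl⟩ := Nat.exists_eq_add_of_le hn
  rw [show (3 + k) * (3 + k) - (3 + k) - (3 + k) = (3 + k) * (1 + k) by
    rw [Nat.sub_sub]
    refine Nat.sub_eq_of_eq_add ?_
    ring]
  push_cast
  ring

end Counting

/-! ### Rooted forests counted by a determinant -/

section AcyclicMaps

variable {V : Type*} {K : Finset V}

/-- Following `g`, every node ends up in `K`. -/
def IsAcyclicMap (K : Finset V) (g : {v // v ∉ K} → V) : Prop :=
  ∃ d : V → ℕ, ∀ u, d (g u) < d u

lemma IsAcyclicMap.ne {g : {v // v ∉ K} → V} (hg : IsAcyclicMap K g) (u : {v // v ∉ K}) :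
    g u ≠ u := by
  obtain ⟨d, hd⟩ := hg
  intro h
  have := hd u
  rw [h] at this
  exact lt_irrefl _ this

variable [DecidableEq V]

/-- The matrix `1 - P`, where `P` is the transition matrix of the map `g` killed in `K`. -/
def mapLaplacian (K : Finset V) (g : {v // v ∉ K} → V) :
    Matrix {v // v ∉ K} {v // v ∉ K} ℝ :=
  Matrix.of fun u v => (if u = v then 1 else 0) - if g u = v then 1 else 0

variable [Fintype V]

/-- Ordered by `d`, the matrix is triangular with unit diagonal. -/
lemma det_mapLaplacian_of_isAcyclicMap {g : {v // v ∉ K} → V} (hg : IsAcyclicMap K g) :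
    (mapLaplacian K g).det = 1 := by
  have hne := hg.ne
  obtain ⟨d, hd⟩ := hg
  have hbt : (mapLaplacian K g).BlockTriangular
      (fun u : {v // v ∉ K} => OrderDual.toDual (d u)) := by
    intro u v huv
    have huv' : d u < d v := huv
    have h1 : u ≠ v := by rintro rfl; exact lt_irrefl _ huv'
    have h2 : g u ≠ v := by
      intro h
      have := hd u
      rw [h] at this
      omega
    simp [mapLaplacian, h1, h2]
  rw [hbt.det]
  refine Finset.prod_eq_one fun a _ => ?_
  have : (mapLaplacian K g).toSquareBlock
      (fun u : {v // v ∉ K} => OrderDual.toDual (d u)) a = 1 := by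
    ext ⟨u, hu⟩ ⟨v, hv⟩
    have huv : d u = d v := OrderDual.toDual.injective (hu.trans hv.symm)
    have h2 : g u ≠ v := by
      intro h
      have := hd u
      rw [h] at this
      omega
    simp [mapLaplacian, Matrix.toSquareBlock, Matrix.toSquareBlockProp, h2, Matrix.one_apply]
  rw [this, Matrix.det_one]

/-- If some node never reaches `K`, the indicator of all such nodes lies in the kernel. Otherwise
the hitting time of `K` serves as `d`. -/
lemma isAcyclicMap_of_det_ne_zero {g : {v // v ∉ K} → V} (h : (mapLaplacian K g).det ≠ 0) :
    IsAcyclicMap K g := by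
  classical
  set step : V → V := fun v => if hv : v ∉ K then g ⟨v, hv⟩ else v with hstep
  have hstep' : ∀ u : {v // v ∉ K}, step u = g u := fun u => dif_pos u.2
  have hreach : ∀ v : V, ∃ t, step^[t] v ∈ K := by
    by_contra! hcon
    obtain ⟨v, hv⟩ := hcon
    refine h (Matrix.exists_mulVec_eq_zero_iff.1
      ⟨fun u => if ∀ t, step^[t] u ∉ K then 1 else 0, ?_, ?_⟩)
    · intro hz
      have := congrFun hz ⟨v, hv 0⟩
      simp [hv] at this
    · have hiff : ∀ u : {v // v ∉ K},
          (∀ t, step^[t] u ∉ K) ↔ ∀ t, step^[t] (g u) ∉ K := by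
        intro u
        constructor
        · intro h t
          have := h (t + 1)
          rwa [Function.iterate_succ_apply, hstep'] at this
        · intro h t
          cases t with
          | zero => exact u.2
          | succ t => rw [Function.iterate_succ_apply, hstep']; exact h t
      ext u
      simp only [Matrix.mulVec, dotProduct, mapLaplacian, Matrix.of_apply, sub_mul, ite_mul,
        one_mul, zero_mul, Finset.sum_sub_distrib, Pi.zero_apply]
      rw [Finset.sum_ite_eq Finset.univ u, if_pos (Finset.mem_univ _)]
      by_cases hgK : g u ∈ K
      · rw [if_neg fun h' => (hiff u).1 h' 0 hgK, Finset.sum_eq_zero, sub_zero]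
        intro w _
        rw [if_neg]
        intro h'
        exact w.2 (h' ▸ hgK)
      · rw [Finset.sum_eq_single ⟨g u, hgK⟩, if_pos rfl]
        · simp only [hiff u, sub_self]
        · intro w _ hw
          rw [if_neg]
          intro h'
          exact hw (Subtype.ext h'.symm)
        · simp
  refine ⟨fun v => Nat.find (hreach v), fun u => ?_⟩
  have h1 := Nat.find_spec (hreach u)
  have h0 : Nat.find (hreach u) ≠ 0 := by
    intro h0
    rw [h0] at h1
    exact u.2 h1
  obtain ⟨t, ht⟩ := Nat.exists_eq_succ_of_ne_zero h0
  rw [ht, Function.iterate_succ_apply, hstep'] at h1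
  change Nat.find (hreach (g u)) < Nat.find (hreach u)
  rw [ht]
  exact Nat.lt_succ_of_le (Nat.find_min' _ h1)

lemma det_sub_ones (c : ℝ) (hc : c ≠ 0) (ι : Type*) [Fintype ι] [DecidableEq ι] :
    (Matrix.of fun u v : ι => (if u = v then c else 0) - 1).det =
      c ^ Fintype.card ι * (1 - Fintype.card ι / c) := by
  have : (Matrix.of fun u v : ι => (if u = v then c else 0) - 1) =
      c • (1 + Matrix.replicateCol Unit (fun _ : ι => -(1 / c)) *
        Matrix.replicateRow Unit (fun _ : ι => (1 : ℝ))) := by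
    ext u v
    simp only [Matrix.of_apply, Matrix.smul_apply, Matrix.add_apply, Matrix.one_apply,
      Matrix.mul_apply, Matrix.replicateCol_apply, Matrix.replicateRow_apply, smul_eq_mul]
    split_ifs <;> simp <;> field_simp
    ring
  rw [this, Matrix.det_smul, Matrix.det_one_add_replicateCol_mul_replicateRow]
  congr 1
  simp [dotProduct]
  ring

/-- The number of forests rooted in `K`. -/
lemma card_isAcyclicMap [Nonempty V] [DecidablePred (IsAcyclicMap K)] :
    ((Finset.univ.filter (IsAcyclicMap K)).card : ℝ) =
      (Fintype.card V : ℝ) ^ Fintype.card {v // v ∉ K} *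
        (1 - Fintype.card {v // v ∉ K} / Fintype.card V) := by
  rw [← det_sub_ones _ (by exact_mod_cast Fintype.card_ne_zero)]
  -- Each row of `n • 1 - J`, with `J` the all-ones matrix and `n` the number of nodes, is a sum
  -- over the possible images `x` of `u`. Multilinearity in the rows expands the determinant into a
  -- sum over all maps `g`, in which acyclic maps contribute `1` and the others `0`.
  have hrow : (Matrix.of fun u v : {v // v ∉ K} =>
      (if u = v then (Fintype.card V : ℝ) else 0) - 1) =
      fun u => ∑ x : V, fun v : {v // v ∉ K} =>
        ((if u = v then (1 : ℝ) else 0) - if x = v then 1 else 0) := by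
    ext u v
    rw [Finset.sum_apply, Finset.sum_sub_distrib]
    simp
  have hdet : Matrix.det (fun u => ∑ x : V, fun v : {v // v ∉ K} =>
        ((if u = v then (1 : ℝ) else 0) - if x = v then 1 else 0)) =
      ∑ g : {v // v ∉ K} → V, Matrix.det (fun u v : {v // v ∉ K} =>
        ((if u = v then (1 : ℝ) else 0) - if g u = v then 1 else 0)) :=
    (Matrix.detRowAlternating (R := ℝ) (n := {v // v ∉ K})).toMultilinearMap.map_sum
      (fun u (x : V) v => ((if u = v then (1 : ℝ) else 0) - if x = (v : V) then 1 else 0))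
  rw [hrow, hdet, Finset.card_filter]
  push_cast
  refine Finset.sum_congr rfl fun g _ => ?_
  change _ = (mapLaplacian K g).det
  split_ifs with h
  · exact (det_mapLaplacian_of_isAcyclicMap h).symm
  · by_contra hne
    exact h (isAcyclicMap_of_det_ne_zero (Ne.symm hne))

end AcyclicMaps

/-! ### Attaching oriented forests to independent arcs -/

section OrientedForest

variable {V : Type*} {K : Finset V} {g : {v // v ∉ K} → V}

/-- The arc between `u` and `g u`, with the orientation given by `ε u`. -/
def forestArc (g : {v // v ∉ K} → V) (hg : ∀ u, g u ≠ u) (ε : {v // v ∉ K} → Bool)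
    (u : {v // v ∉ K}) : Arc V :=
  if ε u then ⟨(u, g u), (hg u).symm⟩ else ⟨(g u, u), hg u⟩

lemma forestArc_cases (hg : ∀ u, g u ≠ u) (ε : {v // v ∉ K} → Bool) (u : {v // v ∉ K}) :
    (ε u = true ∧ (forestArc g hg ε u).tail = u ∧ (forestArc g hg ε u).head = g u) ∨
      (ε u = false ∧ (forestArc g hg ε u).tail = g u ∧ (forestArc g hg ε u).head = u) := by
  cases h : ε u <;> simp [forestArc, h, Arc.tail, Arc.head]

/-- Induction on `d`. If the arc of `u` were assigned by `g'` to its other end `u' = g u`, then `g'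
u' = u`; since `d u' < d u`, also `g u' = u`, and `d` would decrease along a two-cycle. -/
lemma forestArc_inj {g' : {v // v ∉ K} → V} (hg : IsAcyclicMap K g) (hg' : IsAcyclicMap K g')
    {ε ε' : {v // v ∉ K} → Bool}
    (h : Set.range (forestArc g hg.ne ε) = Set.range (forestArc g' hg'.ne ε')) :
    g = g' ∧ ε = ε' := by
  obtain ⟨d, hd⟩ := id hg
  have hex : ∀ u, ∃ u', forestArc g' hg'.ne ε' u' = forestArc g hg.ne ε u := by
    intro u
    have : forestArc g hg.ne ε u ∈ Set.range (forestArc g' hg'.ne ε') := h ▸ ⟨u, rfl⟩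
    exact this
  have hends : ∀ u u', forestArc g' hg'.ne ε' u' = forestArc g hg.ne ε u →
      (u' = u ∧ g' u' = g u ∧ ε' u' = ε u) ∨ ((u' : V) = g u ∧ g' u' = u) := by
    intro u u' huu
    rcases forestArc_cases hg.ne ε u with ⟨h1, h2, h3⟩ | ⟨h1, h2, h3⟩ <;>
    rcases forestArc_cases hg'.ne ε' u' with ⟨h4, h5, h6⟩ | ⟨h4, h5, h6⟩ <;>
    rw [huu] at h5 h6
    · exact Or.inl ⟨Subtype.ext (h5.symm.trans h2), h6.symm.trans h3, h4.trans h1.symm⟩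
    · exact Or.inr ⟨h6.symm.trans h3, h5.symm.trans h2⟩
    · exact Or.inr ⟨h5.symm.trans h2, h6.symm.trans h3⟩
    · exact Or.inl ⟨Subtype.ext (h6.symm.trans h3), h5.symm.trans h2, h4.trans h1.symm⟩
  have key : ∀ N : ℕ, ∀ u : {v // v ∉ K}, d u < N → g u = g' u ∧ ε u = ε' u := by
    intro N
    induction N with
    | zero => intro u hu; omega
    | succ N ih =>
      intro u hu
      obtain ⟨u', hu'⟩ := hex u
      rcases hends u u' hu' with ⟨rfl, h2, h3⟩ | ⟨h1, h2⟩
      · exact ⟨h2.symm, h3.symm⟩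
      · exfalso
        have hdu := hd u
        rw [← h1] at hdu
        have h3 := (ih u' (by omega)).1
        have h4 := hd u'
        rw [h3, h2] at h4
        omega
  exact ⟨funext fun u => (key _ u (Nat.lt_succ_self _)).1,
    funext fun u => (key _ u (Nat.lt_succ_self _)).2⟩

lemma forestArc_injective (hg : IsAcyclicMap K g) (ε : {v // v ∉ K} → Bool) :
    Function.Injective (forestArc g hg.ne ε) := by
  obtain ⟨d, hd⟩ := id hg
  intro u u' huu
  rcases forestArc_cases hg.ne ε u with ⟨h1, h2, h3⟩ | ⟨h1, h2, h3⟩ <;>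
  rcases forestArc_cases hg.ne ε u' with ⟨h4, h5, h6⟩ | ⟨h4, h5, h6⟩ <;>
  rw [← huu] at h5 h6
  · exact Subtype.ext (h2.symm.trans h5)
  · have hdu := hd u
    have hdu' := hd u'
    rw [← h3, h6] at hdu
    rw [← h5, h2] at hdu'
    omega
  · have hdu := hd u
    have hdu' := hd u'
    rw [← h2, h5] at hdu
    rw [← h6, h3] at hdu'
    omega
  · exact Subtype.ext (h3.symm.trans h6)

variable [Fintype V] [DecidableEq V] {β : ℝ} {r : V}

/-- The arcs of the oriented forest. -/
def forestGraph (g : {v // v ∉ K} → V) (hg : ∀ u, g u ≠ u) (ε : {v // v ∉ K} → Bool) :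
    Finset (Arc V) := Finset.univ.image (forestArc g hg ε)

lemma disjoint_forestGraph {S : Finset (Arc V)} (hS : ∀ e ∈ S, e.tail ∈ K ∧ e.head ∈ K)
    (hg : ∀ u, g u ≠ u) (ε : {v // v ∉ K} → Bool) : Disjoint S (forestGraph g hg ε) := by
  rw [Finset.disjoint_left]
  intro e he he'
  obtain ⟨u, -, rfl⟩ := Finset.mem_image.1 he'
  have := hS _ he
  rcases forestArc_cases hg ε u with ⟨-, h2, h3⟩ | ⟨-, h2, h3⟩
  · rw [h2] at this; exact u.2 this.1
  · rw [h3] at this; exact u.2 this.2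

lemma card_union_forestGraph {S : Finset (Arc V)} (hS : ∀ e ∈ S, e.tail ∈ K ∧ e.head ∈ K)
    (hg : IsAcyclicMap K g) (ε : {v // v ∉ K} → Bool) :
    (S ∪ forestGraph g hg.ne ε).card = S.card + Fintype.card {v // v ∉ K} := by
  rw [Finset.card_union_of_disjoint (disjoint_forestGraph hS hg.ne ε), forestGraph,
    Finset.card_image_of_injective _ (forestArc_injective hg ε), Finset.card_univ]

/-- Attaching an oriented forest to independent arcs preserves independence. -/
lemma linearIndepOn_union_forestGraph (h0 : 0 < β) {S : Finset (Arc V)}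
    (hS : ∀ e ∈ S, e.tail ∈ K ∧ e.head ∈ K)
    (hind : LinearIndepOn ℝ (constraintMatrix β r).col (S : Set (Arc V)))
    (hg : IsAcyclicMap K g) (ε : {v // v ∉ K} → Bool) :
    LinearIndepOn ℝ (constraintMatrix β r).col
      ((S ∪ forestGraph g hg.ne ε : Finset (Arc V)) : Set (Arc V)) := by
  rw [linearIndepOn_col_iff] at hind ⊢
  intro y hy hA
  refine hind y (fun e he => ?_) hA
  by_contra hye
  have hmem : e ∈ forestGraph g hg.ne ε := by
    by_contra hcon
    exact hye (hy e (by simp [he, hcon]))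
  obtain ⟨u₀, -, rfl⟩ := Finset.mem_image.1 hmem
  obtain ⟨d, hd⟩ := id hg
  -- Among the nodes whose forest arc carries a nonzero value, one of maximal `d` is taken. Arcs
  -- from nodes mapped to `u` then carry zero, so row `u` isolates the arc of `u`, with coefficient
  -- `1` or `-β`.
  obtain ⟨u, hu, hmax⟩ := Finset.exists_max_image
    (Finset.univ.filter fun u => y (forestArc g hg.ne ε u) ≠ 0) (fun u => d u)
    ⟨u₀, by simpa using hye⟩
  have hu' : y (forestArc g hg.ne ε u) ≠ 0 := (Finset.mem_filter.1 hu).2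
  have hrow : ∑ e, constraintMatrix β r (some u) e * y e = 0 := congrFun hA (some (u : V))
  have hzero : ∀ e : Arc V, e.tail ≠ u → e.head ≠ u → constraintMatrix β r (some u) e = 0 := by
    intro e h1 h2
    simp [constraintMatrix, h1, h2]
  rw [Finset.sum_eq_single (forestArc g hg.ne ε u)] at hrow
  · rcases mul_eq_zero.1 hrow with h | h
    · rcases forestArc_cases hg.ne ε u with ⟨-, h2, h3⟩ | ⟨-, h2, h3⟩
      · simp [constraintMatrix, h2, h3, hg.ne u] at h
      · simp [constraintMatrix, h2, h3, hg.ne u, h0.ne'] at h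
    · exact hu' h
  · intro e _ hne
    by_cases heS : e ∈ S
    · have := hS e heS
      rw [hzero e (fun h => u.2 (h ▸ this.1)) (fun h => u.2 (h ▸ this.2)), zero_mul]
    · by_cases heF : e ∈ forestGraph g hg.ne ε
      · obtain ⟨u', -, rfl⟩ := Finset.mem_image.1 heF
        have huu : (u' : V) ≠ u := fun h => hne (by rw [Subtype.ext h])
        by_cases hgu : g u' = u
        · have hy0 : y (forestArc g hg.ne ε u') = 0 := by
            by_contra hcon
            have h1 := hmax u' (by simpa using hcon)
            have h2 := hd u'
            rw [hgu] at h2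
            omega
          rw [hy0, mul_zero]
        · rcases forestArc_cases hg.ne ε u' with ⟨-, h2, h3⟩ | ⟨-, h2, h3⟩
          · rw [hzero _ (by rwa [h2]) (by rwa [h3]), zero_mul]
          · rw [hzero _ (by rwa [h2]) (by rwa [h3]), zero_mul]
      · rw [hy e (by simp [heS, heF]), mul_zero]
  · simp

end OrientedForest

/-! ### Bases of Type 4 built on a three-node core -/

section Core

variable {V : Type*} [Fintype V] [DecidableEq V] {β : ℝ} {r a b : V}

/-- The union of the short cycle `r → a → r` and the noose path `r → a → b → a`. -/
def coreGraph (r a b : V) : Finset (Arc V) :=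
  Finset.univ.filter fun e => (e.tail = r ∧ e.head = a) ∨ (e.tail = a ∧ e.head = r) ∨
    (e.tail = a ∧ e.head = b) ∨ (e.tail = b ∧ e.head = a)

lemma mem_coreGraph {e : Arc V} : e ∈ coreGraph r a b ↔
    (e.tail = r ∧ e.head = a) ∨ (e.tail = a ∧ e.head = r) ∨
      (e.tail = a ∧ e.head = b) ∨ (e.tail = b ∧ e.head = a) := by simp [coreGraph]

lemma coreGraph_ends {e : Arc V} (he : e ∈ coreGraph r a b) :
    e.tail ∈ ({r, a, b} : Finset V) ∧ e.head ∈ ({r, a, b} : Finset V) := by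
  rcases mem_coreGraph.1 he with ⟨h1, h2⟩ | ⟨h1, h2⟩ | ⟨h1, h2⟩ | ⟨h1, h2⟩ <;> simp [h1, h2]

lemma card_coreGraph (ha : a ≠ r) (hb : b ≠ r) (hab : a ≠ b) : (coreGraph r a b).card = 4 := by
  have : coreGraph r a b =
      {⟨(r, a), ha.symm⟩, ⟨(a, r), ha⟩, ⟨(a, b), hab⟩, ⟨(b, a), hab.symm⟩} := by
    ext ⟨⟨u, v⟩, h⟩
    simp [mem_coreGraph, Arc.tail, Arc.head]
  rw [this, Finset.card_insert_of_notMem, Finset.card_insert_of_notMem, Finset.card_pair]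
  · simp [hab]
  · simp [hb.symm, hab, ha.symm]
  · simp [ha.symm, hb.symm]

lemma coreGraph_inj {a' b' : V} (ha : a ≠ r) (hb : b ≠ r) (hab : a ≠ b) (ha' : a' ≠ r)
    (h : coreGraph r a b = coreGraph r a' b') : a = a' ∧ b = b' := by
  have h1 : (⟨(r, a), ha.symm⟩ : Arc V) ∈ coreGraph r a' b' := by
    rw [← h, mem_coreGraph]; exact Or.inl ⟨rfl, rfl⟩
  have h2 : (⟨(a, b), hab⟩ : Arc V) ∈ coreGraph r a' b' := by
    rw [← h, mem_coreGraph]; exact Or.inr (Or.inr (Or.inl ⟨rfl, rfl⟩))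
  rw [mem_coreGraph] at h1 h2
  simp only [Arc.tail, Arc.head] at h1 h2
  grind

/-- The two walks are `r → a → r` and `r → a → b → a`. Values of the maps off `r`, `a`, `b` are
irrelevant, as the walks never go there; independence is inherited from the larger `pairGraph`. -/
lemma exists_flow_coreGraph (h0 : 0 < β) (h1 : β < 1) (hV : 3 ≤ Fintype.card V) (ha : a ≠ r)
    (hb : b ≠ r) (hab : a ≠ b) :
    LinearIndepOn ℝ (constraintMatrix β r).col (coreGraph r a b : Set (Arc V)) ∧
      ∃ x ∈ hPolytope β r Set.univ, supportArcs x = coreGraph r a b := by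
  set f : V → V := fun v => if v = r then a else if v = a then r else if v = b then a else r
    with hf
  set f' : V → V := fun v => if v = a then b else f v with hf'
  have hfr : f r = a := by simp [hf]
  have hfa : f a = r := by simp [hf]
  have hfb : f b = a := by simp [hf, hb, hab.symm]
  have hfr' : f' r = a := by simp [hf', ha.symm, hfr]
  have hfa' : f' a = b := by simp [hf']
  have hfb' : f' b = a := by simp [hf', hab.symm, hfb]
  have hne : ∀ v, f v ≠ v := by
    intro v
    simp only [hf]
    split_ifs with h2 h3 h4
    · rw [h2]; exact ha
    · rw [h3]; exact ha.symm
    · rw [h4]; exact hab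
    · exact Ne.symm h2
  have hne' : ∀ v, f' v ≠ v := by
    intro v
    simp only [hf']
    split_ifs with h2
    · rw [h2]; exact hab.symm
    · exact hne v
  have hocc : occupation β r f r = 1 / (1 - β ^ 2) := by
    refine occupation_root_of_period h0 h1 two_pos (by simp [hfr, hfa]) fun t ht1 ht2 => ?_
    rw [show t = 1 by omega, Function.iterate_one, hfr]
    exact ha
  have horb : ∀ t, f^[t] r = r ∨ f^[t] r = a := by
    intro t
    induction t with
    | zero => exact Or.inl rfl
    | succ t ih =>
      rw [Function.iterate_succ_apply']
      rcases ih with h | h <;> rw [h]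
      · exact Or.inr hfr
      · exact Or.inl hfa
  have horb' : ∀ t, f'^[t + 1] r = a ∨ f'^[t + 1] r = b := by
    intro t
    induction t with
    | zero => exact Or.inl hfr'
    | succ t ih =>
      rw [Function.iterate_succ_apply']
      rcases ih with h | h <;> rw [h]
      · exact Or.inr hfa'
      · exact Or.inl hfb'
  have hocc' : occupation β r f' r = 1 := by
    refine occupation_root_of_ne fun t => ?_
    rcases horb' t with h | h <;> rw [h]
    · exact ha
    · exact hb
  have hsub : coreGraph r a b ⊆ pairGraph f f' := by
    intro e he
    rw [mem_pairGraph]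
    rcases mem_coreGraph.1 he with ⟨h2, h3⟩ | ⟨h2, h3⟩ | ⟨h2, h3⟩ | ⟨h2, h3⟩ <;> rw [h2, h3]
    · exact Or.inl hfr.symm
    · exact Or.inl hfa.symm
    · exact Or.inr hfa'.symm
    · exact Or.inl hfb.symm
  refine ⟨(linearIndepOn_pairGraph (s := a) h0 h1 hne hne' (fun v hv => by simp [hf', hv])
    ?_).mono (Finset.coe_subset.2 hsub), ?_⟩
  · rw [hocc, hocc']
    have hb0 : 0 < β ^ 2 := by positivity
    have hb1 : β ^ 2 < 1 := pow_lt_one₀ h0.le h1 two_ne_zero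
    rw [Ne, div_eq_one_iff_eq (by linarith)]
    intro h
    linarith
  · obtain ⟨x, hx, hsupp⟩ := exists_mem_hPolytope_supportArcs (r := r) h0 h1 hne hne' two_pos
      (by omega) hocc hocc'
    refine ⟨x, hx, ?_⟩
    rw [hsupp]
    ext e
    simp only [Set.mem_ofPred_eq, Finset.mem_coe, mem_coreGraph]
    constructor
    · rintro (⟨h2, t, ht⟩ | ⟨h2, t, ht⟩)
      · rcases horb t with h3 | h3 <;> rw [h3] at ht <;> rw [← ht] at h2 ⊢
        · exact Or.inl ⟨rfl, h2.trans hfr⟩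
        · exact Or.inr (Or.inl ⟨rfl, h2.trans hfa⟩)
      · cases t with
        | zero =>
          have ht' : r = e.tail := ht
          rw [← ht'] at h2 ⊢
          exact Or.inl ⟨rfl, h2.trans hfr'⟩
        | succ t =>
          rcases horb' t with h3 | h3 <;> rw [h3] at ht <;> rw [← ht] at h2 ⊢
          · exact Or.inr (Or.inr (Or.inl ⟨rfl, h2.trans hfa'⟩))
          · exact Or.inr (Or.inr (Or.inr ⟨rfl, h2.trans hfb'⟩))
    · rintro (⟨h2, h3⟩ | ⟨h2, h3⟩ | ⟨h2, h3⟩ | ⟨h2, h3⟩) <;> rw [h2, h3]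
      · exact Or.inl ⟨hfr.symm, 0, rfl⟩
      · exact Or.inl ⟨hfa.symm, 1, hfr⟩
      · exact Or.inr ⟨hfa'.symm, 1, hfr'⟩
      · exact Or.inr ⟨hfb'.symm, 2, by simp [hfr', hfa']⟩

omit [Fintype V] in
lemma card_core (ha : a ≠ r) (hb : b ≠ r) (hab : a ≠ b) :
    ({r, a, b} : Finset V).card = 3 := by
  rw [Finset.card_insert_of_notMem, Finset.card_pair hab]
  simp [ha.symm, hb.symm]

lemma card_compl_core (ha : a ≠ r) (hb : b ≠ r) (hab : a ≠ b) :
    Fintype.card {v // v ∉ ({r, a, b} : Finset V)} = Fintype.card V - 3 := by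
  rw [Fintype.card_subtype_compl, Fintype.card_coe, card_core ha hb hab]

lemma exists_isFeasibleBasisFor_core (h0 : 0 < β) (h1 : β < 1) (hV : 3 ≤ Fintype.card V)
    (ha : a ≠ r) (hb : b ≠ r) (hab : a ≠ b) {g : {v // v ∉ ({r, a, b} : Finset V)} → V}
    (hg : IsAcyclicMap {r, a, b} g) (ε : {v // v ∉ ({r, a, b} : Finset V)} → Bool) :
    ∃ x, IsFeasibleBasisFor β r Set.univ (coreGraph r a b ∪ forestGraph g hg.ne ε) x ∧
      supportArcs x = coreGraph r a b := by
  obtain ⟨hind, x, hx, hsupp⟩ := exists_flow_coreGraph h0 h1 hV ha hb hab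
  refine ⟨x, ⟨Set.subset_univ _, ?_, ?_, hx, ?_⟩, hsupp⟩
  · rw [card_union_forestGraph (fun e he => coreGraph_ends he) hg, card_coreGraph ha hb hab,
      card_compl_core ha hb hab]
    omega
  · exact linearIndepOn_union_forestGraph h0 (fun e he => coreGraph_ends he) hind hg ε
  · refine eq_zero_of_supportArcs_subset hx ?_
    rw [hsupp]
    exact Finset.coe_subset.2 Finset.subset_union_left

open scoped Classical in
/-- The bases that consist of the core on `r`, `a`, `b` and of an oriented forest rooted there. -/
noncomputable def coreBases (r a b : V) : Finset (Finset (Arc V)) :=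
  Finset.univ.image fun q : {g // IsAcyclicMap ({r, a, b} : Finset V) g} ×
      ({v // v ∉ ({r, a, b} : Finset V)} → Bool) =>
    coreGraph r a b ∪ forestGraph q.1.1 q.1.2.ne q.2

lemma mem_coreBases {B : Finset (Arc V)} : B ∈ coreBases r a b ↔
    ∃ (g : {v // v ∉ ({r, a, b} : Finset V)} → V) (hg : IsAcyclicMap {r, a, b} g)
      (ε : {v // v ∉ ({r, a, b} : Finset V)} → Bool),
      B = coreGraph r a b ∪ forestGraph g hg.ne ε := by
  classical
  rw [coreBases, Finset.mem_image]
  constructor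
  · rintro ⟨⟨⟨g, hg⟩, ε⟩, -, rfl⟩
    exact ⟨g, hg, ε, rfl⟩
  · rintro ⟨g, hg, ε, rfl⟩
    exact ⟨⟨⟨g, hg⟩, ε⟩, Finset.mem_univ _, rfl⟩

/-- Core and forest are disjoint, so the forest and its orientation can be read off the basis. With
`n - 3` nodes outside the core, `n ^ (n - 3) * (1 - (n - 3) / n)` is `3 * n ^ (n - 4)`. -/
lemma card_coreBases (hV : 4 ≤ Fintype.card V) (ha : a ≠ r) (hb : b ≠ r) (hab : a ≠ b) :
    ((coreBases r a b).card : ℝ) =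
      3 * (Fintype.card V : ℝ) ^ (Fintype.card V - 4) * 2 ^ (Fintype.card V - 3) := by
  classical
  have : Nonempty V := ⟨r⟩
  rw [coreBases, Finset.card_image_of_injective, Finset.card_univ, Fintype.card_prod,
    Fintype.card_fun, Fintype.card_bool, card_compl_core ha hb hab, Fintype.card_subtype,
    Nat.cast_mul, card_isAcyclicMap, card_compl_core ha hb hab]
  · set n := Fintype.card V
    obtain ⟨k, hk⟩ := Nat.exists_eq_add_of_le hV
    rw [hk, show 4 + k - 3 = k + 1 by omega, show 4 + k - 4 = k by omega]
    have : ((4 + k : ℕ) : ℝ) ≠ 0 := by positivity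
    rw [pow_succ (((4 + k : ℕ) : ℝ))]
    push_cast at this ⊢
    field_simp
    ring
  · rintro ⟨⟨g, hg⟩, ε⟩ ⟨⟨g', hg'⟩, ε'⟩ heq
    simp only at heq
    have hforest : forestGraph g hg.ne ε = forestGraph g' hg'.ne ε' := by
      rw [← Finset.union_sdiff_cancel_left (disjoint_forestGraph (fun e he => coreGraph_ends he)
        hg.ne ε), heq, Finset.union_sdiff_cancel_left
        (disjoint_forestGraph (fun e he => coreGraph_ends he) hg'.ne ε')]
    have hrange : Set.range (forestArc g hg.ne ε) = Set.range (forestArc g' hg'.ne ε') := by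
      have := congrArg (fun A : Finset (Arc V) => (A : Set (Arc V))) hforest
      simpa [forestGraph] using this
    obtain ⟨rfl, rfl⟩ := forestArc_inj hg hg' hrange
    rfl

/-- A lower bound for the number of bases whose support leaves a node isolated. -/
lemma le_numBases_isolated (h0 : 0 < β) (h1 : β < 1) (hV : 4 ≤ Fintype.card V)
    {T : Set (Arc V) → Prop}
    (hT : ∀ a b, a ≠ r → b ≠ r → a ≠ b → T (coreGraph r a b : Set (Arc V))) :
    ((Fintype.card V : ℝ) - 1) * ((Fintype.card V : ℝ) - 2) *
        (3 * (Fintype.card V : ℝ) ^ (Fintype.card V - 4) * 2 ^ (Fintype.card V - 3)) ≤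
      numBases β r T := by
  classical
  set Q : Finset (V × V) := (Finset.univ.erase r).offDiag with hQ
  have hQmem : ∀ ab, ab ∈ Q ↔ ab.1 ≠ r ∧ ab.2 ≠ r ∧ ab.1 ≠ ab.2 := by
    intro ab
    simp [hQ]
  have hfeas : ∀ ab ∈ Q, ∀ B ∈ coreBases r ab.1 ab.2, ∃ x,
      IsFeasibleBasisFor β r Set.univ B x ∧ supportArcs x = coreGraph r ab.1 ab.2 := by
    intro ab hab B hB
    obtain ⟨ha, hb, hab⟩ := (hQmem _).1 hab
    obtain ⟨g, hg, ε, rfl⟩ := mem_coreBases.1 hB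
    exact exists_isFeasibleBasisFor_core h0 h1 (by omega) ha hb hab hg ε
  have hsub : ((Q.biUnion fun ab => coreBases r ab.1 ab.2 : Finset (Finset (Arc V))) :
      Set (Finset (Arc V))) ⊆
      {B | ∃ x, IsFeasibleBasisFor β r Set.univ B x ∧ T (supportArcs x)} := by
    intro B hB
    obtain ⟨ab, hab, hB⟩ := Finset.mem_biUnion.1 (Finset.mem_coe.1 hB)
    obtain ⟨x, hx, hsupp⟩ := hfeas ab hab B hB
    obtain ⟨ha, hb, hab⟩ := (hQmem _).1 hab
    exact ⟨x, hx, hsupp ▸ hT _ _ ha hb hab⟩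
  -- The core is the support of the unique extreme point of the basis, so the basis determines `a`
  -- and `b`.
  have hdisj : (Q : Set (V × V)).PairwiseDisjoint fun ab => coreBases r ab.1 ab.2 := by
    intro ab hab ab' hab' hne
    refine Finset.disjoint_left.2 fun B hB hB' => hne ?_
    obtain ⟨x, hx, hsupp⟩ := hfeas ab hab B hB
    obtain ⟨y, hy, hsupp'⟩ := hfeas ab' hab' B hB'
    rw [← hx.unique hy, hsupp] at hsupp'
    obtain ⟨ha, hb, hab⟩ := (hQmem _).1 hab
    obtain ⟨ha', -, -⟩ := (hQmem _).1 hab'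
    obtain ⟨h2, h3⟩ := coreGraph_inj ha hb hab ha' (Finset.coe_injective hsupp')
    exact Prod.ext h2 h3
  have hle := Set.ncard_le_ncard hsub (Set.toFinite _)
  rw [Set.ncard_coe_finset, Finset.card_biUnion hdisj] at hle
  have hQcard : (Q.card : ℝ) = ((Fintype.card V : ℝ) - 1) * ((Fintype.card V : ℝ) - 2) := by
    rw [hQ, Finset.offDiag_card, Finset.card_erase_of_mem (Finset.mem_univ _), Finset.card_univ]
    obtain ⟨k, hk⟩ := Nat.exists_eq_add_of_le hV
    rw [hk, show 4 + k - 1 = k + 3 by omega, Nat.cast_sub (Nat.le_mul_self _)]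
    push_cast
    ring
  rw [← hQcard, ← nsmul_eq_mul, ← Finset.sum_const]
  refine le_trans (le_of_eq ?_) (Nat.cast_le.2 hle)
  rw [Nat.cast_sum]
  refine Finset.sum_congr rfl fun ab hab => ?_
  obtain ⟨ha, hb, hab⟩ := (hQmem _).1 hab
  exact (card_coreBases hV ha hb hab).symm

end Core

/-! ### Final comparison and the theorem -/

section Main

/-- The exponent `n - 5` equals `-1` for `n = 4`, hence the integer power; raising it to `n - 4` is
harmless as the base is at least `1`. -/
lemma zpow_bound {n : ℕ} (hn : 4 ≤ n) :
    ((n : ℝ) - 3) ^ ((n : ℤ) - 5) * 2 ^ (n - 4) ≤ 3 * (n : ℝ) ^ (n - 4) * 2 ^ (n - 3) := by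
  obtain ⟨k, rfl⟩ := Nat.exists_eq_add_of_le hn
  have h1 : ((4 + k : ℕ) : ℝ) - 3 = k + 1 := by push_cast; ring
  have h2 : (((4 + k : ℕ) : ℤ) - 5) = (k : ℤ) - 1 := by push_cast; ring
  rw [h1, h2, show 4 + k - 4 = k by omega, show 4 + k - 3 = k + 1 by omega]
  have hk : (1 : ℝ) ≤ (k : ℝ) + 1 := by
    have : (0 : ℝ) ≤ k := Nat.cast_nonneg k
    linarith
  have h3 : ((k : ℝ) + 1) ^ ((k : ℤ) - 1) ≤ ((k : ℝ) + 1) ^ k := by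
    rw [← zpow_natCast]
    exact zpow_le_zpow_right₀ hk (by omega)
  have h4 : ((k : ℝ) + 1) ^ k ≤ ((4 + k : ℕ) : ℝ) ^ k := by
    refine pow_le_pow_left₀ (by positivity) ?_ k
    push_cast
    linarith
  have h5 : (0 : ℝ) ≤ ((4 + k : ℕ) : ℝ) ^ k := by positivity
  have h6 : (2 : ℝ) ^ k ≤ 2 ^ (k + 1) := pow_le_pow_right₀ one_le_two (Nat.le_succ k)
  calc ((k : ℝ) + 1) ^ ((k : ℤ) - 1) * 2 ^ k
      ≤ ((4 + k : ℕ) : ℝ) ^ k * 2 ^ (k + 1) :=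
        mul_le_mul (h3.trans h4) h6 (by positivity) h5
    _ ≤ 3 * ((4 + k : ℕ) : ℝ) ^ k * 2 ^ (k + 1) := by
        refine mul_le_mul_of_nonneg_right ?_ (by positivity)
        linarith

lemma coreGraph_isolated {n : ℕ} [NeZero n] (hn : 4 ≤ n) (a b : Fin n) (ha : a ≠ 0) (hb : b ≠ 0)
    (hab : a ≠ b) : ¬ IsHamiltonianCycle 0 (coreGraph 0 a b : Set (Arc (Fin n))) ∧
      HasIsolatedNode (coreGraph 0 a b : Set (Arc (Fin n))) := by
  have hiso : HasIsolatedNode (coreGraph 0 a b : Set (Arc (Fin n))) := by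
    have hlt : ({0, a, b} : Finset (Fin n)).card < (Finset.univ : Finset (Fin n)).card := by
      rw [card_core ha hb hab, Finset.card_univ, Fintype.card_fin]
      omega
    obtain ⟨v, -, hv⟩ := Finset.exists_mem_notMem_of_card_lt_card hlt
    refine ⟨v, fun e he => ⟨?_, ?_⟩⟩
    · rintro rfl
      exact hv (coreGraph_ends he).1
    · rintro rfl
      exact hv (coreGraph_ends he).2
  refine ⟨fun hham => ?_, hiso⟩
  obtain ⟨v, hv⟩ := hiso
  obtain ⟨σ, -, hS⟩ := (isHamiltonianCycle_iff (by omega)).1 hham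
  refine (hv (arcTo _ (cycleMap_ne (σ := σ) (m := n) (w := 0) (by omega) (by omega)) v) ?_).1 rfl
  rw [hS]
  exact arcTo_head _ _ _

theorem mainTheorem4 (n : ℕ) [NeZero n] (hn : 3 ≤ n) (β : ℝ) (hβ0 : 0 < β) (hβ1 : β < 1)
    (p : unitInterval) :
    expectedNumber p (IsHamiltonianBasis β (0 : Fin n)) =
        ((n : ℝ) - 2) * (n ! : ℝ) * (p : ℝ) ^ (n + 1) ∧
    expectedNumber p (IsNonHamiltonianBasis (IsType1 (0 : Fin n)) β 0) =
        1 / 2 * ((n : ℝ) - 3) * (n ! : ℝ) * (p : ℝ) ^ (n + 1) ∧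
    expectedNumber p (IsNonHamiltonianBasis (IsType2 (0 : Fin n)) β 0) =
        1 / 6 * ((n : ℝ) - 4) * ((n : ℝ) - 3) * ((n : ℝ) + 1) * ((n - 1)! : ℝ) *
          (p : ℝ) ^ (n + 1) ∧
    expectedNumber p (IsNonHamiltonianBasis (IsType3 (0 : Fin n)) β 0) =
        1 / 6 * ((n : ℝ) - 2) * ((n : ℝ) - 1) * (n ! : ℝ) * (p : ℝ) ^ (n + 1) ∧
    (4 ≤ n →
      ((n : ℝ) - 1) * ((n : ℝ) - 2) * ((n : ℝ) - 3) ^ ((n : ℤ) - 5) * 2 ^ (n - 4) *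
          (p : ℝ) ^ (n + 1) ≤
        expectedNumber p (IsNonHamiltonianBasis (HasIsolatedNode (V := Fin n)) β 0)) := by
  rw [expectedNumber_isHamiltonianBasis]
  simp only [expectedNumber_isNonHamiltonianBasis, Fintype.card_fin]
  rw [numBases_hamiltonian hn hβ0 hβ1, numBases_type1 hn hβ0 hβ1, numBases_type2 hn hβ0 hβ1,
    numBases_type3 hn hβ0 hβ1]
  refine ⟨rfl, rfl, rfl, rfl, fun hn4 => ?_⟩
  refine mul_le_mul_of_nonneg_right ?_ (pow_nonneg p.2.1 _)
  have h1 := le_numBases_isolated (r := (0 : Fin n)) hβ0 hβ1 (by simpa using hn4)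
    (T := fun S => ¬ IsHamiltonianCycle 0 S ∧ HasIsolatedNode S) (coreGraph_isolated hn4)
  rw [Fintype.card_fin] at h1
  refine le_trans ?_ h1
  have hn' : (4 : ℝ) ≤ n := by exact_mod_cast hn4
  rw [mul_assoc (((n : ℝ) - 1) * ((n : ℝ) - 2))]
  exact mul_le_mul_of_nonneg_left (zpow_bound hn4)
    (mul_nonneg (by linarith) (by linarith))

end Main
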